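/- Let $S$ be a surface, i.e. a Hausdorff second countable topological $2$-manifold with (possibly empty, possibly disconnected) boundary; $S$ need be neither compact, nor connected, nor orientable. Let $\delta$ be a boundary component of $S$ that is a circle, with four marked points on it, and let $a,b,c,d$ be the closures of the components of the complement of the marked points in $\delta$, labelled so that $a\cap c=\varnothing$ (hence also $b\cap d=\varnothing$). Let $\mathcal A$ be a collection of pairwise disjoint subsets of $S$, each of which is either (i) an essential simple closed curve contained in the interior of $S$, where essential means not homotopic to a constant (curves parallel to a boundary component or to a puncture are allowed); or (ii) an essential simple arc with two distinct endpoints, both on $\delta$, and otherwise contained in the interior of $S$, where essential means not homotopic relative to its endpoints to a path in $\delta$. Assume that $\mathcal A$ is locally finite, i.e. every compact subset of $S$ meets only finitely many elements of $\mathcal A$; that $\mathcal A$ contains only finitely many arcs; and that no arc in $\mathcal A$ has one endpoint in $b$ and the other in $d$. Then there is a path in $S$ from a point of $a$ to a point of $c$ that is disjoint from every element of $\mathcal A$. -/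

import Mathlib

open scoped Manifold

/-- A compact boundary component of a topological surface `S` with boundary, parametrised as a
circle, together with four marked points on it.  The parameters `t 0 < t 1 < t 2 < t 3 < t 0 + 1`
of the marked points list them in the order in which they occur along the circle. -/
structure QuadrangularBoundary (S : Type*) [TopologicalSpace S]
    [ChartedSpace (EuclideanHalfSpace 2) S] where
  /-- the parametrisation of the boundary component by the circle `ℝ / ℤ` -/
  param : C(UnitAddCircle, S)
  injective_param : Function.Injective param
  isComponent : ∃ p ∈ (𝓡∂ 2).boundary S,
    Set.range param = connectedComponentIn ((𝓡∂ 2).boundary S) p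
  /-- the parameters of the four marked points -/
  t : Fin 4 → ℝ
  strictMono_t : StrictMono t
  t_three_lt : t 3 < t 0 + 1

namespace QuadrangularBoundary

variable {S : Type*} [TopologicalSpace S] [ChartedSpace (EuclideanHalfSpace 2) S]
  (Q : QuadrangularBoundary S)

/-- The preferred boundary component, as a subset of the surface. -/
def component : Set S := Set.range Q.param

/-- The closed arc of the boundary component traced by the parameters in `[r, s]`. -/
def segment (r s : ℝ) : Set S := (fun u : ℝ => Q.param (u : UnitAddCircle)) '' Set.Icc r s

/-- The side `a`.  The sides `a`, `b`, `c`, `d`, in cyclic order, are the closures of the components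
of the complement of the marked points in the boundary component; opposite sides are disjoint. -/
def a : Set S := Q.segment (Q.t 0) (Q.t 1)

/-- The side `b`, see `a`. -/
def b : Set S := Q.segment (Q.t 1) (Q.t 2)

/-- The side `c`, see `a`. -/
def c : Set S := Q.segment (Q.t 2) (Q.t 3)

/-- The side `d`, see `a`. -/
def d : Set S := Q.segment (Q.t 3) (Q.t 0 + 1)

end QuadrangularBoundary

/-- `C` is (the image of) an essential simple closed curve in the interior of the surface `S`.
Essential means not homotopic to a constant; curves parallel to a boundary component or to a
puncture are allowed. -/
def IsEssentialSimpleClosedCurve {S : Type*} [TopologicalSpace S]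
    [ChartedSpace (EuclideanHalfSpace 2) S] (C : Set S) : Prop :=
  ∃ γ : C(UnitAddCircle, S), Function.Injective γ ∧ Set.range γ = C ∧
    C ⊆ (𝓡∂ 2).interior S ∧ ¬ γ.Nullhomotopic

/-- `A` is (the image of) an essential simple proper arc of the surface `S` with two distinct
endpoints on the set `δ` (a boundary component); apart from its endpoints it runs in the interior
of `S`.  Essential means not homotopic, relative to its endpoints, to a path in `δ`. -/
def IsEssentialSimpleArc {S : Type*} [TopologicalSpace S]
    [ChartedSpace (EuclideanHalfSpace 2) S] (δ A : Set S) : Prop :=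
  ∃ (p q : S) (α : Path p q), Function.Injective α ∧ Set.range α = A ∧ p ∈ δ ∧ q ∈ δ ∧
    A \ {p, q} ⊆ (𝓡∂ 2).interior S ∧ ¬ ∃ β : Path p q, Set.range β ⊆ δ ∧ α.Homotopic β

/-! Suppose there is no such path. Let `O` be the complement of the union of the family, open by
local finiteness, and let `f` be the indicator function of the points that a path in `O` joins to
the side `a`. Then `f` is locally constant on `O`, equal to 1 on `a ∩ O` and to 0 on `c`. Along the
boundary circle from `a` through `b` to `c`, `f` therefore has an odd number of jumps, each in `b`
and at an end point of an arc. If `f` jumps at one end point of an arc, it jumps at the other one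
too. That one is not in `d`, nor in the open sides `a` and `c`, where `f` has no jump; hence it is
in `b`. So the arcs group the jumps into pairs, and their number is even: a contradiction.

The transfer of jumps along an arc does without tubular neighbourhoods. If `f` does not jump at an
end point, it is constant near that point off the arc. At a first parameter `m` where this constancy
failed, `f` would extend over the part of the arc already passed, to a function locally constant off
the remaining arc, which ends at `α m`. But an arc does not separate a surface locally at its end
point, so constancy holds at `m` after all (`eventually_eq_of_eventually_eq_along_arc`).

The local statement in the plane, `eventually_eq_of_locallyConstant_off_arc`, comes from two
arguments with logarithms: an arc does not separate the plane (`eq_of_locallyConstant_off_arc`), and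
a Mayer–Vietoris splitting (`exists_add_of_locallyConstant_off_union`). Both rest on the existence
of logarithms on star-shaped open sets; the first also on the absence of a logarithm of `z - c` on a
circle about `c`. -/

open Set Filter Topology

/-! ### Separation properties of arcs in the plane, by logarithms. -/

section Plane

theorem eq_of_eventually_eq_of_isPreconnected {X : Type*} [TopologicalSpace X] {S : Set X}
    (hS : IsPreconnected S) {f : X → ℤ} (hf : ∀ x ∈ S, ∀ᶠ y in 𝓝[S] x, f y = f x)
    {x y : X} (hx : x ∈ S) (hy : y ∈ S) : f x = f y :=
  hS.constant (fun z hz => (continuousWithinAt_const (b := f z)).congr_of_eventuallyEq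
    (hf z hz) rfl) hx hy

/-- A star-shaped set is contractible, so the map lifts through the covering `exp` of the punctured
plane. -/
theorem exists_continuousOn_log_of_starConvex {B : Set ℂ} {c : ℂ} (hB : IsOpen B)
    (hs : StarConvex ℝ c B) (hne : B.Nonempty) {h : ℂ → ℂ} (hc : ContinuousOn h B)
    (h0 : ∀ z ∈ B, h z ≠ 0) : ∃ L : ℂ → ℂ, ContinuousOn L B ∧ ∀ z ∈ B, Complex.exp (L z) = h z := by
  classical
  have := hs.contractibleSpace hne
  have := hB.locallyPathConnectedSpace
  obtain ⟨z₀, hz₀⟩ := hne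
  let f : C(B, ℂ) := ⟨B.domRestrict h, continuousOn_iff_continuous_domRestrict.1 hc⟩
  obtain ⟨F, ⟨-, hF⟩, -⟩ := Complex.isCoveringMapOn_exp.existsUnique_continuousMap_lifts f
    (a₀ := ⟨z₀, hz₀⟩) (e₀ := Complex.log (h z₀)) (Complex.exp_log (h0 _ hz₀))
    (fun a => h0 _ a.2)
  refine ⟨fun z => if hz : z ∈ B then F ⟨z, hz⟩ else 0, ?_, fun z hz => ?_⟩
  · rw [continuousOn_iff_continuous_domRestrict]
    convert F.continuous using 1
    ext z
    simp
  · have := congrFun hF ⟨z, hz⟩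
    simp only [hz, dite_true]
    exact this

/-- Logarithms of the same number differ by multiples of `2πi`, so nearby ones coincide. -/
theorem eventually_eq_of_exp_eq {X : Type*} [TopologicalSpace X] {m : X → ℂ} {l : Filter X} {x : X}
    (hm : Tendsto m l (𝓝 (m x))) (h : ∀ᶠ y in l, Complex.exp (m y) = Complex.exp (m x)) :
    ∀ᶠ y in l, m y = m x := by
  have h1 : ∀ᶠ y in l, dist (m y) (m x) < 2 * Real.pi :=
    hm (Metric.ball_mem_nhds _ Real.two_pi_pos)
  filter_upwards [h, h1] with y hy hy1
  obtain ⟨n, hn⟩ := Complex.exp_eq_exp_iff_exists_int.1 hy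
  have : dist (m y) (m x) = |(n : ℝ)| * (2 * Real.pi) := by
    rw [hn, dist_eq_norm, add_sub_cancel_left, norm_mul]
    simp [abs_of_pos Real.pi_pos]
  rw [this] at hy1
  have hn1 : |(n : ℝ)| < 1 := by nlinarith [Real.pi_pos]
  have : n = 0 := by
    rw [← Int.abs_lt_one_iff]; exact_mod_cast hn1
  simp [hn, this]

/-- Along the parametrised circle a logarithm would differ from `t * I` by a constant, contradicting
periodicity. -/
theorem not_exists_log_on_sphere {c : ℂ} {r : ℝ} (hr : 0 < r) {θ : ℂ → ℂ}
    (hθ : ContinuousOn θ (Metric.sphere c r))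
    (h : ∀ z ∈ Metric.sphere c r, Complex.exp (θ z) = z - c) : False := by
  let m : ℝ → ℂ := fun t => θ (circleMap c r t) - t * Complex.I
  have hmem : ∀ t, circleMap c r t ∈ Metric.sphere c r := fun t => circleMap_mem_sphere c hr.le t
  have hm : Continuous m := by
    refine Continuous.sub ?_ (by fun_prop)
    exact hθ.comp_continuous (continuous_circleMap c r) hmem
  have hexp : ∀ t, Complex.exp (m t) = r := fun t => by
    simp only [m, Complex.exp_sub, h _ (hmem t)]
    simp only [circleMap, add_sub_cancel_left]
    field_simp
  have hloc : IsLocallyConstant m := (IsLocallyConstant.iff_eventually_eq m).2 fun x =>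
    eventually_eq_of_exp_eq hm.continuousAt (by simp [hexp])
  have := hloc.apply_eq_of_isPreconnected isPreconnected_univ (mem_univ 0) (mem_univ (2 * Real.pi))
  simp only [m] at this
  have h2 : circleMap c r (2 * Real.pi) = circleMap c r 0 := by
    simpa using periodic_circleMap c r 0
  rw [h2] at this
  have h3 : (2 * (Real.pi : ℂ)) * Complex.I ≠ 0 := Complex.two_pi_I_ne_zero
  rw [eq_comm, Complex.ofReal_zero, zero_mul, sub_zero, sub_eq_self] at this
  apply h3
  simpa only [Complex.ofReal_mul, Complex.ofReal_ofNat] using this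

theorem isPreconnected_norm_gt (M : ℝ) : IsPreconnected {z : ℂ | M < ‖z‖} := by
  have : {z : ℂ | M < ‖z‖} = (fun p : ℝ × ℝ => circleMap 0 p.1 p.2) '' (Ioi M ×ˢ univ) := by
    ext z
    constructor
    · intro hz
      refine ⟨(‖z‖, z.arg), ⟨hz, trivial⟩, ?_⟩
      simp [circleMap, Complex.norm_mul_exp_arg_mul_I]
    · rintro ⟨p, ⟨hp, -⟩, rfl⟩
      have hp : M < p.1 := hp
      simpa [circleMap] using lt_of_lt_of_le hp (le_abs_self _)
  rw [this]
  refine (isPreconnected_Ioi.prod isPreconnected_univ).image _ ?_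
  unfold circleMap
  fun_prop

/-- An arc does not separate the plane. -/
theorem eq_of_locallyConstant_off_arc {a b : ℝ} (hab : a ≤ b) {α : ℝ → ℂ}
    (hα : ContinuousOn α (Icc a b)) (hi : InjOn α (Icc a b)) {f : ℂ → ℤ}
    (hf : ∀ z ∉ α '' Icc a b, ∀ᶠ y in 𝓝 z, f y = f z) {u v : ℂ} (hu : u ∉ α '' Icc a b)
    (hv : v ∉ α '' Icc a b) : f u = f v := by
  classical
  set J := α '' Icc a b with hJ
  have hJc : IsCompact J := isCompact_Icc.image_of_continuousOn hα
  obtain ⟨M, hM0, hM⟩ : ∃ M : ℝ, 0 ≤ M ∧ ∀ z ∈ J, ‖z‖ ≤ M := by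
    obtain ⟨M, hM⟩ := hJc.isBounded.exists_norm_le
    exact ⟨max M 0, le_max_right _ _, fun z hz => (hM z hz).trans (le_max_left _ _)⟩
  have hout : ∀ z, M < ‖z‖ → z ∉ J := fun z hz h => absurd (hM z h) (not_le.2 hz)
  let v₀ : ℂ := (M + 1 : ℝ)
  have hv₀ : M < ‖v₀‖ := by
    simp only [v₀, Complex.norm_real, Real.norm_eq_abs]
    rw [abs_of_pos (by linarith)]; linarith
  suffices H : ∀ u ∉ J, f u = f v₀ by rw [H u hu, H v hv]
  intro u hu
  by_contra hne
  have hbig : ∀ z, M < ‖z‖ → f z = f v₀ := fun z hz =>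
    eq_of_eventually_eq_of_isPreconnected (isPreconnected_norm_gt M)
      (fun x hx => nhdsWithin_le_nhds (hf x (hout x hx))) hz hv₀
  -- If `f u` differs from the value of `f` near infinity, then `W` is a bounded open set containing
  -- `u`, with frontier in the arc `J`.
  let W : Set ℂ := {z | z ∉ J ∧ f z = f u}
  have hWo : IsOpen W := by
    rw [isOpen_iff_mem_nhds]
    rintro z ⟨hz, hz'⟩
    filter_upwards [hf z hz, hJc.isClosed.isOpen_compl.mem_nhds hz] with y hy hyJ
    exact ⟨hyJ, hy.trans hz'⟩
  have hWc : IsClosed (W ∪ J) := by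
    rw [← isOpen_compl_iff, isOpen_iff_mem_nhds]
    intro z hz
    simp only [mem_compl_iff, mem_union, not_or] at hz
    filter_upwards [hf z hz.2, hJc.isClosed.isOpen_compl.mem_nhds hz.2] with y hy hyJ
    rintro (h | h)
    · exact hz.1 ⟨hz.2, hy.symm.trans h.2⟩
    · exact hyJ h
  have hemb : IsClosedEmbedding ((Icc a b).domRestrict α) :=
    (continuousOn_iff_continuous_domRestrict.1 hα).isClosedEmbedding (injOn_iff_injective.1 hi)
  -- Extending the inverse of the parametrisation by Tietze yields a retraction `ρ` of the plane
  -- onto `J`.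
  obtain ⟨g, hg⟩ := ContinuousMap.exists_extension' hemb
    (⟨Subtype.val, continuous_subtype_val⟩ : C(Icc a b, ℝ))
  let ρ : ℂ → ℂ := fun z => α (projIcc a b hab (g z))
  have hρc : Continuous ρ := hα.comp_continuous (by fun_prop) fun z => Subtype.coe_prop _
  have hρJ : ∀ z, ρ z ∈ J := fun z => mem_image_of_mem _ (Subtype.coe_prop _)
  have hρ : ∀ z ∈ J, ρ z = z := by
    rintro _ ⟨t, ht, rfl⟩
    have : g (α t) = t := congrFun hg ⟨t, ht⟩
    simp only [ρ, this, projIcc_of_mem hab ht]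
  -- Borsuk's map: it pushes `W` onto `J` and fixes everything else, so it misses `u` and is the
  -- identity on a large circle. A logarithm of `G - u` on the whole plane would restrict to one of
  -- `z - u` on that circle.
  let G : ℂ → ℂ := fun z => if z ∈ W then ρ z else z
  have hG : Continuous G := by
    rw [← continuousOn_univ]
    have : (univ : Set ℂ) = (W ∪ J) ∪ Wᶜ := by
      ext z; by_cases h : z ∈ W <;> simp [h]
    rw [this]
    refine ContinuousOn.union_of_isClosed ?_ ?_ hWc hWo.isClosed_compl
    · refine hρc.continuousOn.congr fun z hz => ?_
      rcases hz with hz | hz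
      · simp [G, hz]
      · simp only [G, hρ z hz, ite_self]
    · exact continuousOn_id.congr fun z hz => if_neg hz
  have hGu : ∀ z, G z - u ≠ 0 := by
    intro z h
    rw [sub_eq_zero] at h
    by_cases hz : z ∈ W
    · simp only [G, if_pos hz] at h
      exact hu (h ▸ hρJ z)
    · simp only [G, if_neg hz] at h
      exact hz (h ▸ ⟨hu, rfl⟩)
  obtain ⟨L, hL, hLe⟩ := exists_continuousOn_log_of_starConvex isOpen_univ
    (starConvex_univ (𝕜 := ℝ) (0 : ℂ)) univ_nonempty (hG.sub continuous_const).continuousOn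
    fun z _ => hGu z
  refine not_exists_log_on_sphere (c := u) (r := ‖u‖ + M + 1) (by positivity)
    (hL.mono (subset_univ _)) fun z hz => ?_
  rw [hLe z trivial]
  have hz1 : M < ‖z‖ := by
    have h1 : ‖z - u‖ = ‖u‖ + M + 1 := by simpa [dist_eq_norm] using hz
    have := norm_sub_le z u
    linarith
  have : z ∉ W := fun h => hne (h.2.symm.trans (hbig z hz1))
  simp [G, this]

/-- A locally constant function off the union of two closed sets that are disjoint in a convex open
set `B` of the plane splits, in `B`, as a sum of functions locally constant off the two sets. -/
theorem exists_add_of_locallyConstant_off_union {B F₁ F₂ : Set ℂ} (hB : IsOpen B) (hBc : Convex ℝ B)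
    (hBne : B.Nonempty) (h₁ : IsClosed F₁) (h₂ : IsClosed F₂) (n₁ : F₁.Nonempty) (n₂ : F₂.Nonempty)
    (hd : ∀ z ∈ B, z ∈ F₁ → z ∉ F₂) {f : ℂ → ℤ}
    (hf : ∀ z ∈ B, z ∉ F₁ → z ∉ F₂ → ∀ᶠ y in 𝓝 z, f y = f z) :
    ∃ f₁ f₂ : ℂ → ℤ, (∀ z ∈ B, z ∉ F₁ → ∀ᶠ y in 𝓝 z, f₁ y = f₁ z) ∧
      (∀ z ∈ B, z ∉ F₂ → ∀ᶠ y in 𝓝 z, f₂ y = f₂ z) ∧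
      ∀ z ∈ B, z ∉ F₁ → z ∉ F₂ → f z = f₁ z + f₂ z := by
  classical
  let φ : ℂ → ℝ := fun z => Metric.infDist z F₂ / (Metric.infDist z F₁ + Metric.infDist z F₂)
  have hden : ∀ z ∈ B, Metric.infDist z F₁ + Metric.infDist z F₂ ≠ 0 := by
    intro z hz h
    have p1 := Metric.infDist_nonneg (x := z) (s := F₁)
    have p2 := Metric.infDist_nonneg (x := z) (s := F₂)
    exact hd z hz ((h₁.mem_iff_infDist_zero n₁).2 (by linarith))
      ((h₂.mem_iff_infDist_zero n₂).2 (by linarith))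
  have hφ : ∀ z ∈ B, ContinuousAt φ z := fun z hz =>
    (Metric.continuous_infDist_pt F₂).continuousAt.div
      ((Metric.continuous_infDist_pt F₁).add (Metric.continuous_infDist_pt F₂)).continuousAt
      (hden z hz)
  have hφ1 : ∀ z ∈ B, z ∈ F₁ → φ z = 1 := fun z hz h => by
    have h0 := (h₁.mem_iff_infDist_zero n₁).1 h
    have := hden z hz
    simp only [φ, h0, zero_add] at this ⊢
    exact div_self this
  have hφ2 : ∀ z ∈ B, z ∈ F₂ → φ z = 0 := fun z hz h => by
    simp [φ, (h₂.mem_iff_infDist_zero n₂).1 h]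
  -- A cutoff that is 1 near `F₁` and 0 near `F₂`, within `B`.
  let c : ℂ → ℝ := fun z => max 0 (min 1 (3 * φ z - 1))
  have hc : ∀ z ∈ B, ContinuousAt c z := fun z hz =>
    continuousAt_const.max (continuousAt_const.min
      ((continuousAt_const.mul (hφ z hz)).sub continuousAt_const))
  have hc0 : ∀ z, φ z < 1 / 3 → c z = 0 := fun z hz =>
    max_eq_left ((min_le_right _ _).trans (by linarith))
  have hc1 : ∀ z, 2 / 3 < φ z → c z = 1 := fun z hz => by
    simp only [c]; rw [min_eq_left (by linarith), max_eq_right zero_le_one]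
  have near0 : ∀ z ∈ B, z ∈ F₂ → ∀ᶠ y in 𝓝 z, c y = 0 := fun z hz h => by
    filter_upwards [(hφ z hz).eventually_lt_const (by rw [hφ2 z hz h]; norm_num : φ z < 1 / 3)]
      with y hy using hc0 y hy
  have near1 : ∀ z ∈ B, z ∈ F₁ → ∀ᶠ y in 𝓝 z, c y = 1 := fun z hz h => by
    filter_upwards [(hφ z hz).eventually_const_lt (by rw [hφ1 z hz h]; norm_num : 2 / 3 < φ z)]
      with y hy using hc1 y hy
  let T : ℂ := 2 * Real.pi * Complex.I
  have hT : T ≠ 0 := Complex.two_pi_I_ne_zero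
  have expT : ∀ n : ℤ, Complex.exp (n * T) = 1 := fun n => Complex.exp_int_mul_two_pi_mul_I n
  -- The function `2πi f` is split by the cutoff into `p`, continuous across `F₂`, and `q`,
  -- continuous across `F₁`. As `exp p * exp q = 1`, the function `exp p = exp (-q)` is continuous
  -- on all of `B`; subtracting its logarithm from `p` and adding it to `q` makes both into integer
  -- multiples of `2πi`.
  let p : ℂ → ℂ := fun z => if z ∈ F₂ then 0 else f z * c z * T
  let q : ℂ → ℂ := fun z => if z ∈ F₁ then 0 else f z * (1 - c z) * T
  have hp : ∀ z ∈ B, z ∉ F₁ → ContinuousAt p z := by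
    intro z hz hz1
    by_cases hz2 : z ∈ F₂
    · refine continuousAt_const (y := (0 : ℂ)) |>.congr ?_
      filter_upwards [near0 z hz hz2] with y hy
      simp [p, hy]
    · have : ContinuousAt (fun y => (f z : ℂ) * c y * T) z :=
        (continuousAt_const.mul (Complex.continuous_ofReal.continuousAt.comp (hc z hz))).mul
          continuousAt_const
      refine this.congr ?_
      filter_upwards [hf z hz hz1 hz2, h₂.isOpen_compl.mem_nhds hz2] with y hy hy2
      simp only [p, if_neg hy2, hy]
  have hq : ∀ z ∈ B, z ∉ F₂ → ContinuousAt q z := by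
    intro z hz hz2
    by_cases hz1 : z ∈ F₁
    · refine continuousAt_const (y := (0 : ℂ)) |>.congr ?_
      filter_upwards [near1 z hz hz1] with y hy
      simp [q, hy]
    · have : ContinuousAt (fun y => (f z : ℂ) * (1 - c y) * T) z :=
        (continuousAt_const.mul (continuousAt_const.sub
          (Complex.continuous_ofReal.continuousAt.comp (hc z hz)))).mul continuousAt_const
      refine this.congr ?_
      filter_upwards [hf z hz hz1 hz2, h₁.isOpen_compl.mem_nhds hz1] with y hy hy1
      simp only [q, if_neg hy1, hy]
  let h : ℂ → ℂ := fun z => if z ∈ F₁ then Complex.exp (-q z) else Complex.exp (p z)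
  have hpq : ∀ z ∈ B, Complex.exp (p z) * Complex.exp (q z) = 1 := by
    intro z hz
    rw [← Complex.exp_add]
    by_cases hz1 : z ∈ F₁
    · have e := hc1 z (by rw [hφ1 z hz hz1]; norm_num)
      simp only [p, q, if_pos hz1, if_neg (hd z hz hz1), e]
      simpa using expT (f z)
    · by_cases hz2 : z ∈ F₂
      · have e := hc0 z (by rw [hφ2 z hz hz2]; norm_num)
        simp only [p, q, if_neg hz1, if_pos hz2, e]
        simpa using expT (f z)
      · simp only [p, q, if_neg hz1, if_neg hz2]
        refine Eq.trans ?_ (expT (f z))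
        congr 1
        ring
  have hhp : ∀ z ∈ B, h z = Complex.exp (p z) := by
    intro z hz
    by_cases hz1 : z ∈ F₁
    · simp only [h, if_pos hz1, Complex.exp_neg]
      exact (eq_inv_of_mul_eq_one_left (hpq z hz)).symm
    · simp only [h, if_neg hz1]
  have hhq : ∀ z ∈ B, h z * Complex.exp (q z) = 1 := fun z hz => by rw [hhp z hz, hpq z hz]
  have hhc : ContinuousOn h B := by
    intro z hz
    refine ContinuousAt.continuousWithinAt ?_
    by_cases hz2 : z ∈ F₂
    · have hz1 : z ∉ F₁ := fun h1 => hd z hz h1 hz2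
      refine (Complex.continuous_exp.continuousAt.comp (hp z hz hz1)).congr ?_
      filter_upwards [hB.mem_nhds hz] with y hy using (hhp y hy).symm
    · refine (Complex.continuous_exp.continuousAt.comp (hq z hz hz2).neg).congr ?_
      filter_upwards [hB.mem_nhds hz] with y hy
      simp only [Function.comp, Pi.neg_apply, Complex.exp_neg]
      exact (eq_inv_of_mul_eq_one_left (hhq y hy)).symm
  obtain ⟨z₀, hz₀⟩ := hBne
  obtain ⟨L, hL, hLe⟩ := exists_continuousOn_log_of_starConvex hB (hBc.starConvex hz₀) ⟨z₀, hz₀⟩ hhc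
    fun z hz => by rw [hhp z hz]; exact Complex.exp_ne_zero _
  have hLc : ∀ z ∈ B, ContinuousAt L z := fun z hz => hL.continuousAt (hB.mem_nhds hz)
  let m₁ : ℂ → ℂ := fun z => p z - L z
  let m₂ : ℂ → ℂ := fun z => q z + L z
  have e₁ : ∀ z ∈ B, Complex.exp (m₁ z) = 1 := fun z hz => by
    simp only [m₁, Complex.exp_sub, hLe z hz, hhp z hz]
    exact div_self (Complex.exp_ne_zero _)
  have e₂ : ∀ z ∈ B, Complex.exp (m₂ z) = 1 := fun z hz => by
    simp only [m₂, Complex.exp_add, hLe z hz]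
    rw [mul_comm]; exact hhq z hz
  refine ⟨fun z => round (m₁ z / T).re, fun z => round (m₂ z / T).re, ?_, ?_, ?_⟩
  · intro z hz hz1
    have := eventually_eq_of_exp_eq ((hp z hz hz1).sub (hLc z hz)) (m := m₁) (by
      filter_upwards [hB.mem_nhds hz] with y hy
      rw [e₁ y hy, e₁ z hz])
    filter_upwards [this] with y hy
    rw [hy]
  · intro z hz hz2
    have := eventually_eq_of_exp_eq ((hq z hz hz2).add (hLc z hz)) (m := m₂) (by
      filter_upwards [hB.mem_nhds hz] with y hy
      rw [e₂ y hy, e₂ z hz])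
    filter_upwards [this] with y hy
    rw [hy]
  · intro z hz hz1 hz2
    obtain ⟨n₁, hn₁⟩ := Complex.exp_eq_one_iff.1 (e₁ z hz)
    obtain ⟨n₂, hn₂⟩ := Complex.exp_eq_one_iff.1 (e₂ z hz)
    have r₁ : m₁ z / T = (n₁ : ℂ) := by rw [hn₁]; exact mul_div_cancel_right₀ _ hT
    have r₂ : m₂ z / T = (n₂ : ℂ) := by rw [hn₂]; exact mul_div_cancel_right₀ _ hT
    have hs : m₁ z + m₂ z = f z * T := by
      simp only [m₁, m₂, p, q, if_neg hz1, if_neg hz2]; ring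
    have : (f z : ℂ) = ((n₁ + n₂ : ℤ) : ℂ) := by
      push_cast
      rw [← r₁, ← r₂, ← add_div, hs, mul_div_cancel_right₀ _ hT]
    simp only [r₁, r₂, Complex.intCast_re, round_intCast]
    exact_mod_cast this

theorem isPreconnected_sphere_diff_singleton (c : ℂ) {r : ℝ} (hr : 0 < r) {w : ℂ}
    (hw : w ∈ Metric.sphere c r) : IsPreconnected (Metric.sphere c r \ {w}) := by
  have hwr : ‖w - c‖ = r := by simpa [dist_eq_norm] using hw
  set a := (w - c).arg with ha
  have hwa : w = circleMap c r a := by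
    have := Complex.norm_mul_exp_arg_mul_I (w - c)
    rw [hwr] at this
    simp only [circleMap, ha, this, add_sub_cancel]
  have : Metric.sphere c r \ {w} = circleMap c r '' Ioo a (a + 2 * Real.pi) := by
    ext z
    constructor
    · rintro ⟨hz, hzw⟩
      have h1 : z ∈ range (circleMap c r) := by
        rw [range_circleMap, abs_of_pos hr]; exact hz
      rw [← Function.Periodic.image_Icc (periodic_circleMap c r) Real.two_pi_pos a] at h1
      obtain ⟨t, ht, rfl⟩ := h1
      refine ⟨t, ⟨lt_of_le_of_ne ht.1 ?_, lt_of_le_of_ne ht.2 ?_⟩, rfl⟩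
      · rintro rfl
        exact hzw hwa.symm
      · rintro rfl
        exact hzw ((periodic_circleMap c r a).trans hwa.symm)
    · rintro ⟨t, ht, rfl⟩
      refine ⟨circleMap_mem_sphere c hr.le t, fun h => ?_⟩
      rw [mem_singleton_iff, hwa] at h
      have := injOn_circleMap_of_abs_sub_le hr.ne' (a := a) (b := a + 2 * Real.pi)
        (by simp [abs_of_pos Real.pi_pos])
        (by rw [uIoc_of_le (by linarith [Real.pi_pos])]; exact ⟨ht.1, ht.2.le⟩)
        (by rw [uIoc_of_le (by linarith [Real.pi_pos])]; exact ⟨by linarith [Real.pi_pos], le_rfl⟩)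
        (h.trans (periodic_circleMap c r a).symm)
      linarith [ht.2]
  rw [this]
  exact isPreconnected_Ioo.image _ (continuous_circleMap c r).continuousOn

/-- An arc does not separate the plane locally at its end points. -/
theorem eventually_eq_of_locallyConstant_off_arc {α : ℝ → ℂ} {b : ℝ} (hb : 0 < b)
    (hα : ContinuousOn α (Icc 0 b))
    (hi : InjOn α (Icc 0 b)) {f : ℂ → ℤ} {V : Set ℂ} (hV : V ∈ 𝓝 (α 0))
    (hf : ∀ z ∈ V, z ∉ α '' Icc 0 b → ∀ᶠ y in 𝓝 z, f y = f z) :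
    ∃ k, ∀ᶠ z in 𝓝 (α 0), z ∉ α '' Icc 0 b → f z = k := by
  classical
  have h01 : α b ≠ α 0 := fun h =>
    hb.ne' (hi (right_mem_Icc.2 hb.le) (left_mem_Icc.2 hb.le) h)
  obtain ⟨r₀, hr₀, hr₀V⟩ := Metric.mem_nhds_iff.1 hV
  -- The radius is at most the distance to the other end point, so the arc has to leave the open
  -- ball.
  set r := min r₀ (dist (α b) (α 0)) with hr
  have hr0 : 0 < r := lt_min hr₀ (dist_pos.2 h01)
  have hrV : Metric.ball (α 0) r ⊆ V := (Metric.ball_subset_ball (min_le_left _ _)).trans hr₀V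
  set d : ℝ → ℝ := fun t => dist (α t) (α 0) with hd
  have hdc : ContinuousOn d (Icc 0 b) :=
    continuous_dist.comp_continuousOn (hα.prodMk continuousOn_const)
  have hX : IsCompact (Icc 0 b ∩ d ⁻¹' Ici r) :=
    isCompact_Icc.of_isClosed_subset (hdc.preimage_isClosed_of_isClosed isClosed_Icc isClosed_Ici)
      inter_subset_left
  -- The first parameter at which the arc reaches the sphere. By injectivity the pieces before and
  -- after `ε` are disjoint inside the ball.
  obtain ⟨ε, ⟨hε, hεr⟩, hmin⟩ := hX.exists_isLeast ⟨b, right_mem_Icc.2 hb.le, min_le_right r₀ _⟩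
  have hεr : r ≤ d ε := hεr
  have hε0 : 0 < ε := lt_of_le_of_ne hε.1 fun h => by
    rw [← h] at hεr; simp [hd] at hεr; linarith
  have hlt : ∀ t ∈ Ico 0 ε, d t < r := fun t ht => by
    by_contra h
    exact absurd (hmin ⟨⟨ht.1, ht.2.le.trans hε.2⟩, not_lt.1 h⟩) (not_le.2 ht.2)
  have hεr' : d ε = r := by
    obtain ⟨t, ht, htr⟩ := intermediate_value_Icc hε.1 (hdc.mono (Icc_subset_Icc_right hε.2))
      (show r ∈ Icc (d 0) (d ε) from ⟨by simp [hd, hr0.le], hεr⟩)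
    rcases ht.2.eq_or_lt with h | h
    · rw [← h]; exact htr
    · exact absurd htr (hlt t ⟨ht.1, h⟩).ne
  have s₁ : Icc 0 ε ⊆ Icc 0 b := Icc_subset_Icc_right hε.2
  have s₂ : Icc ε b ⊆ Icc 0 b := Icc_subset_Icc_left hε.1
  set B := Metric.ball (α 0) r with hBdef
  set F₁ := α '' Icc 0 ε with hF₁
  set F₂ := α '' Icc ε b with hF₂
  have c₁ : IsClosed F₁ := (isCompact_Icc.image_of_continuousOn (hα.mono s₁)).isClosed
  have c₂ : IsClosed F₂ := (isCompact_Icc.image_of_continuousOn (hα.mono s₂)).isClosed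
  have hεB : α ε ∉ B := fun h => absurd hεr' (ne_of_lt h)
  have hun : ∀ z, z ∉ F₁ → z ∉ F₂ → z ∉ α '' Icc 0 b := by
    rintro z h1 h2 ⟨t, ht, rfl⟩
    rcases le_total t ε with h | h
    · exact h1 ⟨t, ⟨ht.1, h⟩, rfl⟩
    · exact h2 ⟨t, ⟨h, ht.2⟩, rfl⟩
  obtain ⟨f₁, f₂, hf₁, hf₂, hsum⟩ := exists_add_of_locallyConstant_off_union
    (f := f) (F₁ := F₁) (F₂ := F₂)
    Metric.isOpen_ball (convex_ball (α 0) r) ⟨α 0, Metric.mem_ball_self hr0⟩ c₁ c₂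
    ⟨α 0, mem_image_of_mem _ ⟨le_rfl, hε.1⟩⟩ ⟨α b, mem_image_of_mem _ ⟨hε.2, le_rfl⟩⟩
    (by
      rintro _ hz ⟨t, ht, rfl⟩ ⟨s, hs, hst⟩
      have : s = t := hi (s₂ hs) (s₁ ht) hst
      have : t = ε := le_antisymm ht.2 (this ▸ hs.1)
      exact hεB (this ▸ hz))
    (fun z hz h1 h2 => hf z (hrV hz) (hun z h1 h2))
  have hS : ∀ z ∈ Metric.sphere (α 0) r, z ≠ α ε → z ∉ F₁ := by
    rintro _ hz hne ⟨t, ht, rfl⟩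
    rcases ht.2.eq_or_lt with h | h
    · exact hne (h ▸ rfl)
    · exact absurd hz (hlt t ⟨ht.1, h⟩).ne
  have hside : ∀ z ∈ Metric.sphere (α 0) r \ {α ε}, ∃ δ > 0, ∃ k, ∀ y ∈ Metric.ball z δ,
      y ∈ B → f₁ y = k := by
    rintro z ⟨hz, hne⟩
    obtain ⟨δ, hδ, hδF⟩ := Metric.isOpen_iff.1 c₁.isOpen_compl z (hS z hz hne)
    have hpre : IsPreconnected (Metric.ball z δ ∩ B) :=
      ((convex_ball z δ).inter (convex_ball (α 0) r)).isPreconnected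
    by_cases hemp : (Metric.ball z δ ∩ B).Nonempty
    · obtain ⟨y₀, hy₀⟩ := hemp
      exact ⟨δ, hδ, f₁ y₀, fun y hy hyB => eq_of_eventually_eq_of_isPreconnected hpre
        (fun x hx => nhdsWithin_le_nhds (hf₁ x hx.2 (hδF hx.1))) ⟨hy, hyB⟩ hy₀⟩
    · exact ⟨δ, hδ, 0, fun y hy hyB => absurd ⟨y, hy, hyB⟩ hemp⟩
  choose! δ hδ κ hκ using hside
  have hne : ∀ z ∈ Metric.sphere (α 0) r, ∀ U ∈ 𝓝 z, (U ∩ B).Nonempty := by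
    intro z hz U hU
    have : z ∈ closure B := by
      rw [closure_ball _ hr0.ne']; exact Metric.sphere_subset_closedBall hz
    exact mem_closure_iff_nhds.1 this U hU
  have hκc : ∀ z ∈ Metric.sphere (α 0) r \ {α ε}, ∀ᶠ y in 𝓝[Metric.sphere (α 0) r \ {α ε}] z,
      κ y = κ z := by
    intro z hz
    filter_upwards [self_mem_nhdsWithin, nhdsWithin_le_nhds (Metric.ball_mem_nhds z (hδ z hz))]
      with y hy hyz
    obtain ⟨x, ⟨hx1, hx2⟩, hxB⟩ := hne y hy.1 _ (inter_mem (Metric.ball_mem_nhds y (hδ y hy))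
      (Metric.isOpen_ball.mem_nhds hyz))
    rw [← hκ y hy x hx1 hxB, ← hκ z hz x hx2 hxB]
  obtain ⟨k, hk⟩ : ∃ k, ∀ z ∈ Metric.sphere (α 0) r \ {α ε}, κ z = k := by
    have hpre := isPreconnected_sphere_diff_singleton (α 0) hr0 (w := α ε) hεr'
    by_cases hemp : (Metric.sphere (α 0) r \ {α ε}).Nonempty
    · obtain ⟨z₀, hz₀⟩ := hemp
      exact ⟨κ z₀, fun z hz => eq_of_eventually_eq_of_isPreconnected hpre hκc hz hz₀⟩
    · exact ⟨0, fun z hz => absurd ⟨z, hz⟩ hemp⟩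
  -- The first piece meets the sphere in `α ε` only, and the rest of the sphere is connected, so
  -- `f₁` has a single limit value `k` there. Continuing it by `k` outside the ball gives a function
  -- on the plane that is locally constant off the arc `F₁`, hence constant off it.
  let F : ℂ → ℤ := fun z => if z ∈ B then f₁ z else k
  have hF : ∀ z ∉ F₁, ∀ᶠ y in 𝓝 z, F y = F z := by
    intro z hz
    rcases lt_trichotomy (dist z (α 0)) r with h | h | h
    · filter_upwards [Metric.isOpen_ball.mem_nhds h, hf₁ z h hz] with y hyB hy
      simp only [F, if_pos (show y ∈ B from hyB), if_pos (show z ∈ B from h), hy]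
    · have hzB : z ∉ B := fun h' => absurd h (ne_of_lt h')
      have hzS : z ∈ Metric.sphere (α 0) r \ {α ε} :=
        ⟨h, fun h' => hz (h' ▸ mem_image_of_mem _ ⟨hε.1, le_rfl⟩)⟩
      filter_upwards [Metric.ball_mem_nhds z (hδ z hzS)] with y hy
      simp only [F, if_neg hzB]
      split_ifs with hyB
      · rw [hκ z hzS y hy hyB, hk z hzS]
      · rfl
    · have : ∀ᶠ y in 𝓝 z, r < dist y (α 0) :=
        (continuous_id.dist continuous_const).continuousAt.eventually_const_lt h
      filter_upwards [this] with y hy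
      have h1 : z ∉ B := fun h' => absurd h (not_lt.2 (le_of_lt h'))
      have h2 : y ∉ B := fun h' => absurd hy (not_lt.2 (le_of_lt h'))
      simp only [F, if_neg h1, if_neg h2]
  have hconst : ∃ k₁, ∀ z ∈ B, z ∉ F₁ → f₁ z = k₁ := by
    by_cases hemp : ∃ z₀ ∈ B, z₀ ∉ F₁
    · obtain ⟨z₀, hz₀B, hz₀⟩ := hemp
      refine ⟨f₁ z₀, fun z hz hzF => ?_⟩
      have := eq_of_locallyConstant_off_arc hε.1 (hα.mono s₁) (hi.mono s₁) hF hzF hz₀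
      simpa only [F, if_pos hz, if_pos hz₀B] using this
    · push Not at hemp
      exact ⟨0, fun z hz hzF => absurd (hemp z hz) hzF⟩
  obtain ⟨k₁, hk₁⟩ := hconst
  have h0F₂ : α 0 ∉ F₂ := by
    rintro ⟨t, ht, h⟩
    have := hi (s₂ ht) (left_mem_Icc.2 hb.le) h
    linarith [ht.1]
  have h0B : α 0 ∈ B := Metric.mem_ball_self hr0
  refine ⟨k₁ + f₂ (α 0), ?_⟩
  filter_upwards [hf₂ _ h0B h0F₂, Metric.isOpen_ball.mem_nhds h0B, c₂.isOpen_compl.mem_nhds h0F₂]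
    with z hz hzB hz2 hzα
  have hz1 : z ∉ F₁ := fun h => hzα (image_mono s₁ h)
  rw [hsum z hzB hz1 hz2, hk₁ z hzB hz1, hz]

end Plane

/-! ### Charts in the closed half-plane, and local separation in a surface. -/

section HalfPlane

/-- The coordinates of a point of the half-plane, as a complex number in the closed upper
half-plane. -/
def halfCoord (x : EuclideanHalfSpace 2) : ℂ := ⟨x.1 1, x.1 0⟩

/-- The point of the half-plane nearest to a complex number. -/
noncomputable def halfPoint (w : ℂ) : EuclideanHalfSpace 2 := ⟨!₂[max 0 w.im, w.re], by simp⟩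

theorem continuous_halfCoord : Continuous halfCoord := by
  have : halfCoord = fun x => Complex.equivRealProdCLM.symm (x.1 1, x.1 0) := by
    ext x
    simp [halfCoord, Complex.equivRealProdCLM_symm_apply, Complex.ext_iff]
  rw [this]
  have h : Continuous fun x : EuclideanHalfSpace 2 => x.1 := continuous_subtype_val
  fun_prop

theorem continuous_halfPoint : Continuous halfPoint := by
  refine Continuous.subtype_mk ?_ _
  refine (PiLp.continuous_toLp 2 _).comp (continuous_pi fun i => ?_)
  fin_cases i
  · exact continuous_const.max Complex.continuous_im
  · exact Complex.continuous_re

theorem halfPoint_halfCoord (x : EuclideanHalfSpace 2) : halfPoint (halfCoord x) = x := by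
  apply EuclideanHalfSpace.ext
  ext i
  fin_cases i
  · simpa [halfPoint, halfCoord] using x.2
  · simp [halfPoint, halfCoord]

theorem halfCoord_im_nonneg (x : EuclideanHalfSpace 2) : 0 ≤ (halfCoord x).im := x.2

theorem halfCoord_halfPoint_of_nonneg {w : ℂ} (hw : 0 ≤ w.im) : halfCoord (halfPoint w) = w := by
  simp [halfPoint, halfCoord, hw]

theorem halfCoord_halfPoint_re (w : ℂ) : (halfCoord (halfPoint w)).re = w.re := by
  simp [halfPoint, halfCoord]

theorem halfCoord_halfPoint_im (w : ℂ) : (halfCoord (halfPoint w)).im = max 0 w.im := by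
  simp [halfPoint, halfCoord]

variable {S : Type*} [TopologicalSpace S]

/-- A chart of a surface with boundary, with values in the closed upper half-plane of `ℂ`. -/
noncomputable def planeCoord (e : OpenPartialHomeomorph S (EuclideanHalfSpace 2)) (z : S) : ℂ := halfCoord (e z)

/-- The inverse of `planeCoord`, precomposed with the nearest point projection. -/
noncomputable def planePoint (e : OpenPartialHomeomorph S (EuclideanHalfSpace 2)) (w : ℂ) : S :=
  e.symm (halfPoint w)

/-- The open set of the plane on which `planePoint` is meaningful. -/
noncomputable def planeDomain (e : OpenPartialHomeomorph S (EuclideanHalfSpace 2)) : Set ℂ :=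
  halfPoint ⁻¹' e.target

variable (e : OpenPartialHomeomorph S (EuclideanHalfSpace 2))

theorem isOpen_planeDomain : IsOpen (planeDomain e) := e.open_target.preimage continuous_halfPoint

variable {e}

theorem planeCoord_mem_planeDomain {z : S} (hz : z ∈ e.source) : planeCoord e z ∈ planeDomain e := by
  simp only [planeDomain, planeCoord, mem_preimage, halfPoint_halfCoord]
  exact e.map_source hz

theorem planePoint_planeCoord {z : S} (hz : z ∈ e.source) : planePoint e (planeCoord e z) = z := by
  simp only [planePoint, planeCoord, halfPoint_halfCoord]
  exact e.left_inv hz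

theorem planeCoord_planePoint {w : ℂ} (hw : w ∈ planeDomain e) :
    planeCoord e (planePoint e w) = halfCoord (halfPoint w) := by
  simp only [planePoint, planeCoord]
  rw [e.right_inv hw]

theorem planeCoord_planePoint_of_nonneg {w : ℂ} (hw : w ∈ planeDomain e) (h : 0 ≤ w.im) :
    planeCoord e (planePoint e w) = w := by
  rw [planeCoord_planePoint hw, halfCoord_halfPoint_of_nonneg h]

theorem continuousAt_planeCoord {z : S} (hz : z ∈ e.source) : ContinuousAt (planeCoord e) z :=
  continuous_halfCoord.continuousAt.comp (e.continuousAt hz)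

theorem continuousAt_planePoint {w : ℂ} (hw : w ∈ planeDomain e) : ContinuousAt (planePoint e) w :=
  (e.continuousAt_symm hw).comp continuous_halfPoint.continuousAt

theorem tendsto_planePoint {z : S} (hz : z ∈ e.source) :
    Tendsto (planePoint e) (𝓝 (planeCoord e z)) (𝓝 z) := by
  have := continuousAt_planePoint (planeCoord_mem_planeDomain hz)
  rwa [ContinuousAt, planePoint_planeCoord hz] at this

theorem planePoint_mem_source {w : ℂ} (hw : w ∈ planeDomain e) : planePoint e w ∈ e.source :=
  e.map_target hw

theorem injOn_planeCoord : InjOn (planeCoord e) e.source := fun x hx y hy h => by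
  rw [← planePoint_planeCoord hx, h, planePoint_planeCoord hy]

/-- The disc of centre `c` and radius `r`, slit along the radius that points downwards. -/
def slitBall (c : ℂ) (r : ℝ) : Set ℂ := Metric.ball c r ∩ {w | c.im < w.im ∨ w.re ≠ c.re}

theorem isOpen_slitBall (c : ℂ) (r : ℝ) : IsOpen (slitBall c r) :=
  Metric.isOpen_ball.inter ((isOpen_lt continuous_const Complex.continuous_im).union
    (isOpen_ne_fun Complex.continuous_re continuous_const))

theorem slitBall_center_mem {c : ℂ} {r : ℝ} (hr : 0 < r) :
    c + (r / 2 : ℝ) * Complex.I ∈ slitBall c r := by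
  refine ⟨?_, Or.inl ?_⟩
  · rw [Metric.mem_ball, dist_eq_norm, add_sub_cancel_left, norm_mul, Complex.norm_I, mul_one,
      Complex.norm_real, Real.norm_eq_abs, abs_of_pos (by linarith)]
    linarith
  · simp [hr]

/-- The base point lies straight above the slit, so no segment from it to a point off the slit can
cross the slit. -/
theorem starConvex_slitBall {c : ℂ} {r : ℝ} (hr : 0 < r) :
    StarConvex ℝ (c + (r / 2 : ℝ) * Complex.I) (slitBall c r) := by
  intro w hw a b ha hb hab
  refine ⟨convex_ball c r (slitBall_center_mem hr).1 hw.1 ha hb hab, ?_⟩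
  simp only [mem_ofPred_eq, Complex.add_im, Complex.add_re, Complex.real_smul, Complex.mul_im,
    Complex.mul_re, Complex.ofReal_re, Complex.ofReal_im, Complex.I_re, Complex.I_im]
  obtain rfl : a = 1 - b := by linarith
  by_cases h : w.re = c.re
  · left
    have hwi : c.im < w.im := hw.2.resolve_right (not_not.2 h)
    rcases hb.eq_or_lt with rfl | hb
    · simp; linarith
    · nlinarith [mul_nonneg ha hr.le, mul_pos hb (sub_pos.2 hwi)]
  · rcases hb.eq_or_lt with rfl | hb
    · left; simp; linarith
    · right
      intro h'
      apply h
      have : b * (w.re - c.re) = 0 := by linarith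
      rcases mul_eq_zero.1 this with h0 | h0
      · linarith
      · linarith

/-- For `c` on the real axis, the fibre over `c` of the projection onto the half-plane is the
vertical ray downwards from `c`, which is what the slit removes. The slit disc thus serves as a
star-shaped open substitute for a half-disc punctured at `c`. -/
theorem halfCoord_halfPoint_ne_of_mem_slitBall {c w : ℂ} {r : ℝ} (hc : c.im = 0)
    (hw : w ∈ slitBall c r) : halfCoord (halfPoint w) ≠ c := by
  intro h
  have h1 := congrArg Complex.re h
  have h2 := congrArg Complex.im h
  rw [halfCoord_halfPoint_re] at h1
  rw [halfCoord_halfPoint_im, hc] at h2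
  rcases hw.2 with h3 | h3
  · rw [hc] at h3
    exact absurd h2 (ne_of_gt (lt_max_of_lt_right h3))
  · exact h3 h1

theorem mem_slitBall_of_ne {c w : ℂ} {r : ℝ} (hc : c.im = 0) (hw : w ∈ Metric.ball c r)
    (h0 : 0 ≤ w.im) (hne : w ≠ c) : w ∈ slitBall c r := by
  refine ⟨hw, ?_⟩
  by_contra h
  simp only [mem_ofPred_eq, not_or, not_lt, not_not, hc] at h
  exact hne (Complex.ext h.2 (by rw [hc]; exact le_antisymm h.1 h0))

/-- Invariance of the boundary: whether a point is on the boundary does not depend on the chart. -/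
theorem planeCoord_im_eq_zero {e e' : OpenPartialHomeomorph S (EuclideanHalfSpace 2)} {z : S}
    (hz : z ∈ e.source) (hz' : z ∈ e'.source) (h : (planeCoord e z).im = 0) :
    (planeCoord e' z).im = 0 := by
  by_contra hne
  have hpos : 0 < (planeCoord e' z).im :=
    lt_of_le_of_ne (halfCoord_im_nonneg _) (Ne.symm hne)
  obtain ⟨r, hr, hrs⟩ : ∃ r > 0, ∀ w ∈ Metric.ball (planeCoord e z) r,
      w ∈ planeDomain e ∧ planePoint e w ∈ e'.source := by
    refine Metric.mem_nhds_iff.1 (inter_mem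
      ((isOpen_planeDomain e).mem_nhds (planeCoord_mem_planeDomain hz)) ?_)
    exact tendsto_planePoint hz (e'.open_source.mem_nhds hz')
  obtain ⟨L, hL, hLe⟩ := exists_continuousOn_log_of_starConvex (isOpen_slitBall _ r)
    (starConvex_slitBall hr) ⟨_, slitBall_center_mem hr⟩
    (h := fun w => planeCoord e' (planePoint e w) - planeCoord e' z)
    (fun w hw => ContinuousAt.continuousWithinAt <|
      ((continuousAt_planeCoord (hrs w hw.1).2).comp (continuousAt_planePoint (hrs w hw.1).1)).sub
        continuousAt_const)
    (by
      intro w hw h0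
      have h1 := injOn_planeCoord (hrs w hw.1).2 hz' (sub_eq_zero.1 h0)
      have h2 := planeCoord_planePoint (hrs w hw.1).1
      rw [h1] at h2
      exact halfCoord_halfPoint_ne_of_mem_slitBall h hw h2.symm)
  have hμ : Tendsto (fun v => planeCoord e (planePoint e' v)) (𝓝 (planeCoord e' z))
      (𝓝 (planeCoord e z)) := (continuousAt_planeCoord hz).tendsto.comp (tendsto_planePoint hz')
  have hev : ∀ᶠ v in 𝓝 (planeCoord e' z), v ∈ planeDomain e' ∧ 0 < v.im ∧
      planePoint e' v ∈ e.source ∧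
      planeCoord e (planePoint e' v) ∈ Metric.ball (planeCoord e z) r := by
    filter_upwards [(isOpen_planeDomain e').mem_nhds (planeCoord_mem_planeDomain hz'),
      Complex.continuous_im.continuousAt.eventually_const_lt hpos,
      tendsto_planePoint hz' (e.open_source.mem_nhds hz), hμ (Metric.ball_mem_nhds _ hr)]
      with v h1 h2 h3 h4 using ⟨h1, h2, h3, h4⟩
  obtain ⟨ρ, hρ, hρs⟩ := Metric.nhds_basis_closedBall.mem_iff.1 hev
  have hsl : ∀ v ∈ Metric.sphere (planeCoord e' z) ρ,
      planeCoord e (planePoint e' v) ∈ slitBall (planeCoord e z) r := by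
    intro v hv
    obtain ⟨h1, h2, h3, h4⟩ := hρs (Metric.sphere_subset_closedBall hv)
    refine mem_slitBall_of_ne h h4 (halfCoord_im_nonneg _) fun h5 => ?_
    have h6 := injOn_planeCoord h3 hz h5
    have h7 := planeCoord_planePoint_of_nonneg h1 h2.le
    rw [h6] at h7
    rw [h7, Metric.mem_sphere, dist_self] at hv
    exact hρ.ne hv
  -- A small circle about the supposed interior point is carried by the change of charts into the
  -- slit disc; the logarithm found there pulls back to a forbidden one on the circle.
  refine not_exists_log_on_sphere (c := planeCoord e' z) hρ (θ := fun v => L (planeCoord e (planePoint e' v))) ?_ ?_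
  · refine hL.comp (fun v hv => ?_) hsl
    obtain ⟨h1, h2, h3, h4⟩ := hρs (Metric.sphere_subset_closedBall hv)
    exact ((continuousAt_planeCoord h3).comp (continuousAt_planePoint h1)).continuousWithinAt
  · intro v hv
    obtain ⟨h1, h2, h3, h4⟩ := hρs (Metric.sphere_subset_closedBall hv)
    rw [hLe _ (hsl v hv), planePoint_planeCoord h3, planeCoord_planePoint_of_nonneg h1 h2.le]

/-- An arc in a surface does not separate it locally at its end point `y`; if `y` is on the
boundary, the function is assumed constant on the boundary near `y`. -/
theorem eventually_eq_of_locallyConstant_off_arc_of_chart [T2Space S] {β : ℝ → S} {b : ℝ}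
    (hb : 0 < b) (hβ : ContinuousOn β (Icc 0 b)) (hi : InjOn β (Icc 0 b)) (hy : β 0 ∈ e.source)
    {f : S → ℤ} {V : Set S} (hV : V ∈ 𝓝 (β 0))
    (hf : ∀ z ∈ V, z ∉ β '' Icc 0 b → ∀ᶠ x in 𝓝 z, f x = f z) {k₀ : ℤ}
    (hk : ∀ᶠ z in 𝓝 (β 0), (planeCoord e z).im = 0 → z ≠ β 0 → f z = k₀) :
    ∃ k, ∀ᶠ z in 𝓝 (β 0), z ∉ β '' Icc 0 b → f z = k := by
  classical
  obtain ⟨ε, hε, hεs⟩ : ∃ ε ∈ Ioc 0 b, ∀ t ∈ Icc 0 ε, β t ∈ e.source := by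
    have h1 := hβ 0 (left_mem_Icc.2 hb.le) (e.open_source.mem_nhds hy)
    obtain ⟨ε, hε, hs⟩ := Metric.mem_nhdsWithin_iff.1 h1
    refine ⟨min (ε / 2) b, ⟨lt_min (by linarith) hb, min_le_right _ _⟩, fun t ht => ?_⟩
    refine hs ⟨?_, ht.1, ht.2.trans (min_le_right _ _)⟩
    rw [Metric.mem_ball, Real.dist_eq, sub_zero, abs_of_nonneg ht.1]
    exact (ht.2.trans (min_le_left _ _)).trans_lt (by linarith)
  have s₁ : Icc 0 ε ⊆ Icc 0 b := Icc_subset_Icc_right hε.2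
  have s₂ : Icc ε b ⊆ Icc 0 b := Icc_subset_Icc_left hε.1.le
  have c₂ : IsClosed (β '' Icc ε b) := (isCompact_Icc.image_of_continuousOn (hβ.mono s₂)).isClosed
  have h0F₂ : β 0 ∉ β '' Icc ε b := by
    rintro ⟨t, ht, h⟩
    have := hi (s₂ ht) (left_mem_Icc.2 hb.le) h
    linarith [ht.1, hε.1]
  let α : ℝ → ℂ := fun t => planeCoord e (β t)
  have hα : ContinuousOn α (Icc 0 ε) := fun t ht =>
    (continuousAt_planeCoord (hεs t ht)).comp_continuousWithinAt (hβ.mono s₁ t ht)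
  have hαi : InjOn α (Icc 0 ε) := fun t ht s hs h =>
    hi (s₁ ht) (s₁ hs) (injOn_planeCoord (hεs t ht) (hεs s hs) h)
  -- Below the real axis the function is continued by its boundary value `k₀`, which makes it
  -- locally constant at the nearby real points off the arc.
  let F : ℂ → ℤ := fun w => if 0 ≤ w.im then f (planePoint e w) else k₀
  have hev : ∀ᶠ w in 𝓝 (α 0), w ∈ planeDomain e ∧ planePoint e w ∈ V ∧
      planePoint e w ∉ β '' Icc ε b ∧ ((planeCoord e (planePoint e w)).im = 0 →
        planePoint e w ≠ β 0 → f (planePoint e w) = k₀) := by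
    filter_upwards [(isOpen_planeDomain e).mem_nhds (planeCoord_mem_planeDomain hy),
      tendsto_planePoint hy hV, tendsto_planePoint hy (c₂.isOpen_compl.mem_nhds h0F₂),
      (tendsto_planePoint hy).eventually hk] with w h1 h2 h3 h4 using ⟨h1, h2, h3, h4⟩
  obtain ⟨k, hk⟩ := eventually_eq_of_locallyConstant_off_arc (f := F) hε.1 hα hαi hev (by
    rintro w ⟨hw, hwV, hw2, hwk⟩ hwα
    rcases lt_or_ge w.im 0 with him | him
    · filter_upwards [Complex.continuous_im.continuousAt.eventually_lt_const him] with v hv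
      simp only [F, if_neg (not_le.2 him), if_neg (not_le.2 hv)]
    have hcw := planeCoord_planePoint_of_nonneg hw him
    have hwβ : planePoint e w ∉ β '' Icc 0 b := by
      rintro ⟨t, ht, h⟩
      rcases le_total t ε with hte | hte
      · refine hwα ⟨t, ⟨ht.1, hte⟩, ?_⟩
        simp only [α, h, hcw]
      · exact hw2 ⟨t, ⟨hte, ht.2⟩, h⟩
    have hloc := (continuousAt_planePoint hw).eventually (hf _ hwV hwβ)
    rcases him.eq_or_lt with him0 | him0
    · have hfk : f (planePoint e w) = k₀ := hwk (by rw [hcw, ← him0]) fun h =>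
        hwβ (h ▸ mem_image_of_mem _ (left_mem_Icc.2 hb.le))
      filter_upwards [hloc] with v hv
      simp only [F, if_pos him, hv, hfk, ite_self]
    · filter_upwards [hloc, Complex.continuous_im.continuousAt.eventually_const_lt him0]
        with v hv hv0
      simp only [F, if_pos him, if_pos hv0.le, hv])
  refine ⟨k, ?_⟩
  filter_upwards [(continuousAt_planeCoord hy).eventually hk, e.open_source.mem_nhds hy]
    with z hz hzs hzβ
  rw [← hz ?_]
  · simp only [F, if_pos (show 0 ≤ (planeCoord e z).im from halfCoord_im_nonneg _),
      planePoint_planeCoord hzs]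
  · rintro ⟨t, ht, h⟩
    exact hzβ ⟨t, s₁ ht, injOn_planeCoord (hεs t ht) hzs h⟩

/-- A half-disc stays connected when the centre of its diameter is removed. -/
theorem eventually_eq_of_locallyConstant_off_boundary_point {y : S} (hy : y ∈ e.source)
    (h0 : (planeCoord e y).im = 0) {f : S → ℤ} {V : Set S} (hV : V ∈ 𝓝 y)
    (hf : ∀ z ∈ V, z ≠ y → ∀ᶠ x in 𝓝 z, f x = f z) : ∃ k, ∀ᶠ z in 𝓝 y, z ≠ y → f z = k := by
  obtain ⟨r, hr, hrs⟩ : ∃ r > 0, ∀ w ∈ Metric.ball (planeCoord e y) r,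
      w ∈ planeDomain e ∧ planePoint e w ∈ V :=
    Metric.mem_nhds_iff.1 (inter_mem
      ((isOpen_planeDomain e).mem_nhds (planeCoord_mem_planeDomain hy)) (tendsto_planePoint hy hV))
  have hpre : IsPreconnected (slitBall (planeCoord e y) r) :=
    ((starConvex_slitBall hr).isPathConnected
      (slitBall_center_mem hr)).isConnected.isPreconnected
  have hloc : ∀ w ∈ slitBall (planeCoord e y) r, ∀ᶠ v in 𝓝[slitBall (planeCoord e y) r] w,
      f (planePoint e v) = f (planePoint e w) := by
    intro w hw
    obtain ⟨h1, h2⟩ := hrs w hw.1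
    refine nhdsWithin_le_nhds ((continuousAt_planePoint h1).eventually (hf _ h2 fun h => ?_))
    have h3 := planeCoord_planePoint h1
    rw [h] at h3
    exact halfCoord_halfPoint_ne_of_mem_slitBall h0 hw h3.symm
  refine ⟨f (planePoint e (planeCoord e y + (r / 2 : ℝ) * Complex.I)), ?_⟩
  filter_upwards [e.open_source.mem_nhds hy,
    continuousAt_planeCoord hy (Metric.ball_mem_nhds _ hr)] with z hzs hz hne
  have := eq_of_eventually_eq_of_isPreconnected hpre hloc
    (mem_slitBall_of_ne h0 hz (halfCoord_im_nonneg _) fun h => hne (injOn_planeCoord hzs hy h))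
    (slitBall_center_mem hr)
  rwa [planePoint_planeCoord hzs] at this

end HalfPlane

/-! ### Propagation of local constancy along an arc. -/

section Arcs

variable {S : Type*} [TopologicalSpace S]

theorem mem_boundary_iff_planeCoord [ChartedSpace (EuclideanHalfSpace 2) S] {x : S} :
    x ∈ (𝓡∂ 2).boundary S ↔ (planeCoord (chartAt (EuclideanHalfSpace 2) x) x).im = 0 := by
  change (𝓡∂ 2).IsBoundaryPoint x ↔ _
  rw [ModelWithCorners.isBoundaryPoint_iff, frontier_range_modelWithCornersEuclideanHalfSpace]
  exact eq_comm

theorem mem_boundary_iff_planeCoord_of_mem_source [ChartedSpace (EuclideanHalfSpace 2) S] {x : S}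
    {e : OpenPartialHomeomorph S (EuclideanHalfSpace 2)} (hx : x ∈ e.source) :
    x ∈ (𝓡∂ 2).boundary S ↔ (planeCoord e x).im = 0 :=
  mem_boundary_iff_planeCoord.trans
    ⟨planeCoord_im_eq_zero (mem_chart_source _ x) hx,
      planeCoord_im_eq_zero hx (mem_chart_source _ x)⟩

theorem planeCoord_im_pos_of_mem_interior [ChartedSpace (EuclideanHalfSpace 2) S] {x : S}
    (hx : x ∈ (𝓡∂ 2).interior S) : 0 < (planeCoord (chartAt (EuclideanHalfSpace 2) x) x).im := by
  refine lt_of_le_of_ne (halfCoord_im_nonneg _) fun h => ?_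
  have := mem_boundary_iff_planeCoord.2 h.symm
  rw [← ModelWithCorners.compl_interior] at this
  exact this hx

theorem isClosedEmbedding_of_continuousOn_Icc [T2Space S] {a b : ℝ} {α : ℝ → S}
    (hα : ContinuousOn α (Icc a b)) (hi : InjOn α (Icc a b)) :
    IsClosedEmbedding ((Icc a b).domRestrict α) :=
  (continuousOn_iff_continuous_domRestrict.1 hα).isClosedEmbedding (injOn_iff_injective.1 hi)

/-- An arc has empty interior near the interior points of a surface. -/
theorem exists_notMem_arc [T2Space S] {e : OpenPartialHomeomorph S (EuclideanHalfSpace 2)} {x : S}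
    (hx : x ∈ e.source) (hpos : 0 < (planeCoord e x).im) {a b : ℝ} {α : ℝ → S}
    (hα : ContinuousOn α (Icc a b)) (hi : InjOn α (Icc a b)) {N : Set S} (hN : N ∈ 𝓝 x) :
    ∃ y ∈ N, y ∉ α '' Icc a b := by
  by_contra! hcon
  obtain ⟨r, hr, hrs⟩ := Metric.nhds_basis_closedBall.mem_iff.1 (inter_mem
    ((isOpen_planeDomain e).mem_nhds (planeCoord_mem_planeDomain hx)) (inter_mem
      (tendsto_planePoint hx hN) (Complex.continuous_im.continuousAt.eventually_const_lt hpos)))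
  set c := planeCoord e x
  have hmem : ∀ θ, circleMap c r θ ∈ Metric.closedBall c r := fun θ =>
    Metric.sphere_subset_closedBall (circleMap_mem_sphere c hr.le θ)
  -- If the arc filled a neighbourhood, a small circle would map injectively and continuously into
  -- an interval. But `τ θ - τ (θ + π)` changes sign, so two antipodal points have the same image.
  choose τ hτ hτα using fun θ => hcon _ (hrs (hmem θ)).2.1
  have hτc : Continuous fun θ => (⟨τ θ, hτ θ⟩ : Icc a b) := by
    rw [(isClosedEmbedding_of_continuousOn_Icc hα hi).isInducing.continuous_iff]
    have : (Icc a b).domRestrict α ∘ (fun θ => (⟨τ θ, hτ θ⟩ : Icc a b)) =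
        fun θ => planePoint e (circleMap c r θ) := funext hτα
    rw [this, continuous_iff_continuousAt]
    exact fun θ => ContinuousAt.comp (f := circleMap c r)
      (continuousAt_planePoint (hrs (hmem θ)).1) (continuous_circleMap c r).continuousAt
  have hτc' : Continuous τ := continuous_subtype_val.comp hτc
  have hinj : ∀ θ θ', τ θ = τ θ' → circleMap c r θ = circleMap c r θ' := fun θ θ' h => by
    have h1 : planePoint e (circleMap c r θ) = planePoint e (circleMap c r θ') := by
      rw [← hτα, ← hτα, h]
    rw [← planeCoord_planePoint_of_nonneg (hrs (hmem θ)).1 (hrs (hmem θ)).2.2.le, h1,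
      planeCoord_planePoint_of_nonneg (hrs (hmem θ')).1 (hrs (hmem θ')).2.2.le]
  have hper : τ (Real.pi + Real.pi) = τ 0 := by
    apply hi (hτ _) (hτ _)
    rw [hτα, hτα]
    congr 1
    have := periodic_circleMap c r 0
    rwa [zero_add, two_mul] at this
  have hh : Continuous fun θ => τ θ - τ (θ + Real.pi) := by fun_prop
  obtain ⟨θ, -, hθ⟩ : (0 : ℝ) ∈ (fun θ => τ θ - τ (θ + Real.pi)) '' uIcc 0 Real.pi := by
    refine intermediate_value_uIcc hh.continuousOn ?_
    simp only [zero_add, hper]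
    rw [← neg_sub (τ 0) (τ Real.pi)]
    rcases le_total 0 (τ 0 - τ Real.pi) with h | h
    · exact mem_uIcc.2 (Or.inr ⟨by linarith, h⟩)
    · exact mem_uIcc.2 (Or.inl ⟨h, by linarith⟩)
  have h2 := hinj _ _ (sub_eq_zero.1 hθ)
  simp only [circleMap, add_right_inj, Complex.ofReal_add, add_mul, Complex.exp_add,
    Complex.exp_pi_mul_I] at h2
  have h3 : (r : ℂ) * Complex.exp (θ * Complex.I) = 0 := by linear_combination h2 / 2
  simp [hr.ne', Complex.exp_ne_zero] at h3

/-- If a function that is locally constant off an arc in a surface is constant near the first end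
point of the arc, then it is constant near the last one, too. -/
theorem eventually_eq_of_eventually_eq_along_arc [T2Space S]
    [ChartedSpace (EuclideanHalfSpace 2) S] {α : ℝ → S} (hα : ContinuousOn α (Icc 0 1))
    (hi : InjOn α (Icc 0 1)) (hint : ∀ t ∈ Ioo (0 : ℝ) 1, α t ∈ (𝓡∂ 2).interior S)
    (hb : α 1 ∈ (𝓡∂ 2).boundary S) {U : Set S} (hU : IsOpen U) (hAU : α '' Icc 0 1 ⊆ U)
    {f : S → ℤ} (hf : ∀ z ∈ U, z ∉ α '' Icc 0 1 → ∀ᶠ x in 𝓝 z, f x = f z)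
    (h0 : ∃ k, ∀ᶠ z in 𝓝 (α 0), z ∉ α '' Icc 0 1 → f z = k) :
    ∃ k, ∀ᶠ z in 𝓝 (α 1), z ∉ α '' Icc 0 1 → f z = k := by
  classical
  set A := α '' Icc 0 1 with hA
  let C : S → Prop := fun z => ∃ k, ∀ᶠ x in 𝓝 z, x ∉ A → f x = k
  have hCo : IsOpen {z | C z} := by
    rw [isOpen_iff_mem_nhds]
    rintro z ⟨k, hk⟩
    filter_upwards [eventually_eventually_nhds.2 hk] with x hx using ⟨k, hx⟩
  -- Density of the complement of the arc makes the constant value near a point unique.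
  have hdense : ∀ z, ∀ N ∈ 𝓝 z, ∃ y ∈ N, y ∉ A := by
    intro z N hN
    by_cases hz : z ∈ A
    · obtain ⟨t, ht, rfl⟩ := hz
      have htc : t ∈ closure (Ioo (0 : ℝ) 1) := by
        rw [closure_Ioo zero_ne_one]; exact ht
      have hpre : α ⁻¹' interior N ∈ 𝓝[Icc 0 1] t :=
        hα t ht (interior_mem_nhds.2 hN)
      obtain ⟨W, hW, hWs⟩ := mem_nhdsWithin_iff_exists_mem_nhds_inter.1 hpre
      obtain ⟨s, hsW, hs⟩ := mem_closure_iff_nhds.1 htc W hW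
      have hsN : α s ∈ interior N := hWs ⟨hsW, Ioo_subset_Icc_self hs⟩
      exact exists_notMem_arc (mem_chart_source _ (α s))
        (planeCoord_im_pos_of_mem_interior (hint s hs)) hα hi (mem_interior_iff_mem_nhds.1 hsN)
    · exact ⟨z, mem_of_mem_nhds hN, hz⟩
  have hCU : ∀ z ∈ U, z ∉ A → C z := fun z hz hzA => ⟨f z, (hf z hz hzA).mono fun x hx _ => hx⟩
  -- `κ` extends `f` across those points of the arc near which `f` is constant off the arc.
  choose! κ hκ using (fun z (hz : C z) => hz : ∀ z, C z → ∃ k, ∀ᶠ x in 𝓝 z, x ∉ A → f x = k)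
  have hκf : ∀ z ∈ U, z ∉ A → κ z = f z := fun z hz hzA =>
    ((hκ z (hCU z hz hzA)).self_of_nhds hzA).symm
  have hκloc : ∀ z, C z → ∀ᶠ x in 𝓝 z, κ x = κ z := by
    intro z hz
    filter_upwards [eventually_eventually_nhds.2 (hκ z hz)] with x hx
    have hxC : C x := ⟨_, hx⟩
    obtain ⟨y, ⟨hy1, hy2⟩, hyA⟩ := hdense x _ (hx.and (hκ x hxC))
    rw [← hy1 hyA, hy2 hyA]
  have hlift : ∀ z ∈ U, (∃ k, ∀ᶠ x in 𝓝 z, x ∉ A → κ x = k) → C z := by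
    rintro z hz ⟨k, hk⟩
    refine ⟨k, ?_⟩
    filter_upwards [hk, hU.mem_nhds hz] with x hx hxU hxA
    rw [← hκf x hxU hxA, hx hxA]
  suffices H : ∀ t ∈ Icc (0 : ℝ) 1, C (α t) from H 1 (right_mem_Icc.2 zero_le_one)
  by_contra! hbad
  have hcl : IsClosed (Icc (0 : ℝ) 1 ∩ α ⁻¹' {z | C z}ᶜ) :=
    hα.preimage_isClosed_of_isClosed isClosed_Icc hCo.isClosed_compl
  obtain ⟨t₀, ht₀, ht₀C⟩ := hbad
  -- The first parameter at which constancy fails. By minimality `κ` is locally constant in `U` off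
  -- the remaining arc, which begins at `α m`.
  obtain ⟨m, ⟨hm, hmC⟩, hmin⟩ :=
    (isCompact_Icc.of_isClosed_subset hcl inter_subset_left).exists_isLeast ⟨t₀, ht₀, ht₀C⟩
  have hgood : ∀ t ∈ Ico 0 m, C (α t) := fun t ht => by
    by_contra h
    exact absurd (hmin ⟨⟨ht.1, ht.2.le.trans hm.2⟩, h⟩) (not_le.2 ht.2)
  have hm0 : 0 < m := lt_of_le_of_ne hm.1 fun h => hmC (h ▸ h0)
  have hmU : α m ∈ U := hAU (mem_image_of_mem _ hm)
  have hκU : ∀ z ∈ U, z ∉ α '' Icc m 1 → ∀ᶠ x in 𝓝 z, κ x = κ z := by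
    intro z hz hzm
    apply hκloc
    by_cases hzA : z ∈ A
    · obtain ⟨t, ht, rfl⟩ := hzA
      exact hgood t ⟨ht.1, lt_of_not_ge fun h => hzm ⟨t, ⟨h, ht.2⟩, rfl⟩⟩
    · exact hCU z hz hzA
  apply hmC
  apply hlift _ hmU
  rcases hm.2.eq_or_lt with rfl | hm1
  · obtain ⟨k, hk⟩ := eventually_eq_of_locallyConstant_off_boundary_point
      (mem_chart_source _ (α 1)) (mem_boundary_iff_planeCoord.1 hb) (hU.mem_nhds hmU)
      (fun z hz hne => hκU z hz (by simpa using hne))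
    exact ⟨k, hk.mono fun x hx hxA => hx fun h => hxA (h ▸ mem_image_of_mem _ hm)⟩
  · have himg : (fun s => α (m + s)) '' Icc 0 (1 - m) = α '' Icc m 1 := by
      have : Icc m 1 = (fun s => m + s) '' Icc 0 (1 - m) := by simp
      rw [this, image_image]
    have hmaps : MapsTo (fun s => m + s) (Icc 0 (1 - m)) (Icc 0 1) := fun s hs =>
      ⟨add_nonneg hm.1 hs.1, by linarith [hs.2]⟩
    have hpos := planeCoord_im_pos_of_mem_interior (hint m ⟨hm0, hm1⟩)
    -- As `α m` is an interior point, the condition on boundary values is vacuous and `k₀` is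
    -- arbitrary.
    obtain ⟨k, hk⟩ := eventually_eq_of_locallyConstant_off_arc_of_chart
      (β := fun s => α (m + s)) (e := chartAt (EuclideanHalfSpace 2) (α m)) (f := κ) (V := U)
      (k₀ := 0) (sub_pos.2 hm1) (hα.comp (by fun_prop) hmaps)
      (hi.comp (add_right_injective m).injOn hmaps)
      (by simp) (by simpa using hU.mem_nhds hmU)
      (by rw [himg]; exact hκU)
      (by
        rw [add_zero]
        filter_upwards [(continuousAt_planeCoord (mem_chart_source _ (α m))).eventually
          (Complex.continuous_im.continuousAt.eventually_const_lt hpos)] with z hz h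
        exact absurd h hz.ne')
    rw [himg, add_zero] at hk
    exact ⟨k, hk.mono fun x hx hxA => hx fun h => hxA (image_mono (Icc_subset_Icc_left hm.1) h)⟩

end Arcs

/-! ### The boundary component and the transfer of jumps between end points. -/

section Boundary

variable {S : Type*} [TopologicalSpace S] [ChartedSpace (EuclideanHalfSpace 2) S]

/-- The boundary of a surface is locally connected. -/
theorem connectedComponentIn_boundary_mem_nhdsWithin {p : S} (hp : p ∈ (𝓡∂ 2).boundary S) :
    connectedComponentIn ((𝓡∂ 2).boundary S) p ∈ 𝓝[(𝓡∂ 2).boundary S] p := by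
  set e := chartAt (EuclideanHalfSpace 2) p
  have hpe : p ∈ e.source := mem_chart_source _ p
  have h0 : (planeCoord e p).im = 0 := mem_boundary_iff_planeCoord.1 hp
  obtain ⟨r, hr, hrs⟩ := Metric.mem_nhds_iff.1
    ((isOpen_planeDomain e).mem_nhds (planeCoord_mem_planeDomain hpe))
  set I : Set ℂ := Metric.ball (planeCoord e p) r ∩ {w | w.im = 0}
  have hI : IsPreconnected I := by
    refine ((convex_ball _ r).inter ?_).isPreconnected
    intro x hx y hy a b _ _ _
    have hx : x.im = 0 := hx
    have hy : y.im = 0 := hy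
    simp [hx, hy]
  have himg : IsPreconnected (planePoint e '' I) := hI.image _ fun w hw =>
    (continuousAt_planePoint (hrs hw.1)).continuousWithinAt
  have hsub : planePoint e '' I ⊆ (𝓡∂ 2).boundary S := by
    rintro _ ⟨w, ⟨hw, hw0⟩, rfl⟩
    have hw0 : w.im = 0 := hw0
    rw [mem_boundary_iff_planeCoord_of_mem_source (planePoint_mem_source (hrs hw)),
      planeCoord_planePoint_of_nonneg (hrs hw) hw0.ge, hw0]
  have hpI : p ∈ planePoint e '' I :=
    ⟨planeCoord e p, ⟨Metric.mem_ball_self hr, h0⟩, planePoint_planeCoord hpe⟩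
  have hcomp := himg.subset_connectedComponentIn hpI hsub
  filter_upwards [self_mem_nhdsWithin, nhdsWithin_le_nhds (e.open_source.mem_nhds hpe),
    nhdsWithin_le_nhds (continuousAt_planeCoord hpe (Metric.ball_mem_nhds _ hr))] with z hz hze hzr
  exact hcomp ⟨planeCoord e z, ⟨hzr, (mem_boundary_iff_planeCoord_of_mem_source hze).1 hz⟩,
    planePoint_planeCoord hze⟩

theorem QuadrangularBoundary.component_subset_boundary (Q : QuadrangularBoundary S) :
    Q.component ⊆ (𝓡∂ 2).boundary S := by
  obtain ⟨p, -, h⟩ := Q.isComponent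
  exact h.trans_subset (connectedComponentIn_subset _ _)

theorem QuadrangularBoundary.eventually_mem_component (Q : QuadrangularBoundary S) {x : S}
    (hx : x ∈ Q.component) : ∀ᶠ z in 𝓝 x, z ∈ (𝓡∂ 2).boundary S → z ∈ Q.component := by
  have hb := Q.component_subset_boundary hx
  obtain ⟨p, -, h⟩ := Q.isComponent
  have h : Q.component = _ := h
  rw [h] at hx ⊢
  rw [connectedComponentIn_eq hx]
  exact mem_nhdsWithin_iff_eventually.1 (connectedComponentIn_boundary_mem_nhdsWithin hb)

/-- If a function locally constant off a proper arc takes the same value on both sides of the first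
end point of the arc along the boundary component `δ`, then so it does at the last end point. -/
theorem eventually_eq_along_boundary_of_path [T2Space S] {δ : Set S}
    (hδ : δ ⊆ (𝓡∂ 2).boundary S)
    (hδ' : ∀ x ∈ δ, ∀ᶠ z in 𝓝 x, z ∈ (𝓡∂ 2).boundary S → z ∈ δ) {p q : S} (α : Path p q)
    (hi : Function.Injective α) (hp : p ∈ δ) (hq : q ∈ δ)
    (hint : range α \ {p, q} ⊆ (𝓡∂ 2).interior S) {U : Set S} (hU : IsOpen U) (hAU : range α ⊆ U)
    {f : S → ℤ} (hf : ∀ z ∈ U, z ∉ range α → ∀ᶠ x in 𝓝 z, f x = f z)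
    (h : ∃ k, ∀ᶠ z in 𝓝 p, z ∈ δ → z ≠ p → f z = k) :
    ∃ k, ∀ᶠ z in 𝓝 q, z ∈ δ → z ≠ q → f z = k := by
  have himg : α.extend '' Icc 0 1 = range α := by
    ext z
    constructor
    · rintro ⟨t, ht, rfl⟩
      exact ⟨⟨t, ht⟩, (α.extend_apply ht).symm⟩
    · rintro ⟨t, rfl⟩
      exact ⟨t, t.2, α.extend_apply t.2⟩
  have hinj : InjOn α.extend (Icc 0 1) := fun s hs t ht hst => by
    rw [α.extend_apply hs, α.extend_apply ht] at hst
    exact congrArg Subtype.val (hi hst)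
  have h0 : α.extend 0 = p := α.extend_zero
  have h1 : α.extend 1 = q := α.extend_one
  have hpq : p ≠ q := fun hpq => zero_ne_one
    (hinj (left_mem_Icc.2 zero_le_one) (right_mem_Icc.2 zero_le_one) (by rw [h0, h1, hpq]))
  have hpe := mem_chart_source (EuclideanHalfSpace 2) p
  obtain ⟨k, hk⟩ := h
  have hCp := eventually_eq_of_locallyConstant_off_arc_of_chart
    (e := chartAt (EuclideanHalfSpace 2) p) (β := α.extend) (V := U) (f := f) (k₀ := k)
    zero_lt_one α.continuous_extend.continuousOn hinj (by rwa [h0])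
    (by rw [h0]; exact hU.mem_nhds (hAU ⟨0, α.source⟩)) (by rwa [himg])
    (by
      rw [h0]
      filter_upwards [hk, hδ' p hp, (chartAt (EuclideanHalfSpace 2) p).open_source.mem_nhds hpe]
        with z hz hzδ hze hz0 hzp
      exact hz (hzδ ((mem_boundary_iff_planeCoord_of_mem_source hze).2 hz0)) hzp)
  obtain ⟨k', hk'⟩ := eventually_eq_of_eventually_eq_along_arc (f := f)
    α.continuous_extend.continuousOn hinj
    (by
      intro t ht
      have ht' := Ioo_subset_Icc_self ht
      refine hint ⟨himg ▸ mem_image_of_mem _ ht', ?_⟩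
      rintro (h | h)
      · exact ht.1.ne (hinj (left_mem_Icc.2 zero_le_one) ht' (by rw [h0, h]))
      · exact ht.2.ne (hinj ht' (right_mem_Icc.2 zero_le_one) (by rw [h1, h])))
    (by rw [h1]; exact hδ hq) hU (by rwa [himg]) (by rwa [himg]) hCp
  rw [himg, h1] at hk'
  refine ⟨k', ?_⟩
  filter_upwards [hk', isOpen_ne.mem_nhds hpq.symm] with z hz hzp hzδ hzq
  refine hz fun hzA => ?_
  have := hint ⟨hzA, by simp only [mem_insert_iff, mem_singleton_iff, not_or]; exact ⟨hzp, hzq⟩⟩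
  rw [← ModelWithCorners.compl_boundary] at this
  exact this (hδ hzδ)

/-- An essential simple arc has, besides any end point `x`, exactly one other end point `y`, and a
function locally constant off the arc jumps at `y` along the boundary if it jumps at `x`. -/
theorem IsEssentialSimpleArc.exists_other_endpoint [T2Space S] {δ : Set S}
    (hδ : δ ⊆ (𝓡∂ 2).boundary S)
    (hδ' : ∀ x ∈ δ, ∀ᶠ z in 𝓝 x, z ∈ (𝓡∂ 2).boundary S → z ∈ δ) {A : Set S}
    (hA : IsEssentialSimpleArc δ A) {x : S} (hxA : x ∈ A) (hxδ : x ∈ δ) :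
    ∃ y ∈ A ∩ δ, y ≠ x ∧ A ∩ δ ⊆ {x, y} ∧ ∀ U : Set S, IsOpen U → A ⊆ U → ∀ f : S → ℤ,
      (∀ z ∈ U, z ∉ A → ∀ᶠ x in 𝓝 z, f x = f z) →
      (∃ k, ∀ᶠ z in 𝓝 y, z ∈ δ → z ≠ y → f z = k) →
      ∃ k, ∀ᶠ z in 𝓝 x, z ∈ δ → z ≠ x → f z = k := by
  obtain ⟨p, q, α, hi, rfl, hp, hq, hint, -⟩ := hA
  have hpA : p ∈ range α := ⟨0, α.source⟩
  have hqA : q ∈ range α := ⟨1, α.target⟩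
  have hpq : p ≠ q := fun h => zero_ne_one (hi (by rw [α.source, α.target, h]))
  have hsub : range α ∩ δ ⊆ {p, q} := by
    rintro z ⟨hz, hzδ⟩
    by_contra hne
    have := hint ⟨hz, hne⟩
    rw [← ModelWithCorners.compl_boundary] at this
    exact this (hδ hzδ)
  rcases hsub ⟨hxA, hxδ⟩ with rfl | rfl
  · refine ⟨q, ⟨hqA, hq⟩, hpq.symm, hsub, fun U hU hAU f hf => ?_⟩
    have hr : range α.symm = range α := α.symm_range
    exact eventually_eq_along_boundary_of_path hδ hδ' α.symm
      (hi.comp unitInterval.symm_bijective.injective) hq hp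
      (by rw [hr, pair_comm]; exact hint) hU (by rwa [hr]) (by rwa [hr])
  · refine ⟨p, ⟨hpA, hp⟩, hpq, by rwa [pair_comm], fun U hU hAU f hf => ?_⟩
    exact eventually_eq_along_boundary_of_path hδ hδ' α hi hp hq hint hU hAU hf

end Boundary

/-! ### Counting jumps modulo 2. -/

section Parity

/-- A function on the line with values `0` and `1`, locally constant off a finite set, changes its
value between `s` and `t` if and only if it has an odd number of jumps there. -/
theorem odd_card_jumps_iff {g : ℝ → ℤ} (hg : ∀ u, g u = 0 ∨ g u = 1) {s : ℝ}
    [DecidablePred fun u => ¬ ∃ k, ∀ᶠ v in 𝓝[≠] u, g v = k] (P : Finset ℝ) :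
    ∀ t, s < t → s ∉ P → t ∉ P → (∀ u ∈ Icc s t, u ∉ P → ∀ᶠ v in 𝓝 u, g v = g u) →
      (Odd ({u ∈ P | u ∈ Ioo s t ∧ ¬ ∃ k, ∀ᶠ v in 𝓝[≠] u, g v = k} : Finset ℝ).card ↔
        g s ≠ g t) := by
  classical
  induction P using Finset.induction_on_max with
  | empty =>
    intro t hst _ _ hloc
    have : g s = g t := eq_of_eventually_eq_of_isPreconnected isPreconnected_Icc
      (fun u hu => nhdsWithin_le_nhds (hloc u hu (by simp))) (left_mem_Icc.2 hst.le)
      (right_mem_Icc.2 hst.le)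
    simp [this]
  | insert x P hmax ih =>
    intro t hst hs ht hloc
    have hxP : x ∉ P := fun h => lt_irrefl _ (hmax x h)
    have hsx : s ≠ x := fun h => hs (h ▸ Finset.mem_insert_self _ _)
    have htx : t ≠ x := fun h => ht (h ▸ Finset.mem_insert_self _ _)
    have hsP : s ∉ P := fun h => hs (Finset.mem_insert_of_mem h)
    have htP : t ∉ P := fun h => ht (Finset.mem_insert_of_mem h)
    by_cases hx : x ∈ Ioo s t
    · obtain ⟨t', ht'x, hst', ht'P⟩ : ∃ t' < x, s < t' ∧ ∀ y ∈ P, y < t' := by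
        have h1 : ∀ᶠ t' in 𝓝[<] x, s < t' ∧ ∀ y ∈ P, y < t' := by
          refine ((eventually_gt_nhds hx.1).filter_mono nhdsWithin_le_nhds).and ?_
          exact (Finset.eventually_all P).2 fun y hy =>
            (eventually_gt_nhds (hmax y hy)).filter_mono nhdsWithin_le_nhds
        obtain ⟨t', h2, h3⟩ := (h1.and self_mem_nhdsWithin).exists
        exact ⟨t', h3, h2⟩
      have hloc' : ∀ u ∈ Icc t' t, u ≠ x → ∀ᶠ v in 𝓝 u, g v = g u := fun u hu hux =>
        hloc u ⟨hst'.le.trans hu.1, hu.2⟩ (by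
          rw [Finset.mem_insert, not_or]
          exact ⟨hux, fun h => absurd (ht'P u h) (not_lt.2 hu.1)⟩)
      have hleft : ∀ v ∈ Ico t' x, g v = g t' := fun v hv =>
        eq_of_eventually_eq_of_isPreconnected isPreconnected_Ico
          (fun u hu => nhdsWithin_le_nhds (hloc' u ⟨hu.1, hu.2.le.trans hx.2.le⟩ hu.2.ne)) hv
          ⟨le_rfl, ht'x⟩
      have hright : ∀ v ∈ Ioc x t, g v = g t := fun v hv =>
        eq_of_eventually_eq_of_isPreconnected isPreconnected_Ioc
          (fun u hu => nhdsWithin_le_nhds (hloc' u ⟨ht'x.le.trans hu.1.le, hu.2⟩ hu.1.ne')) hv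
          ⟨hx.2, le_rfl⟩
      have hjump : (∃ k, ∀ᶠ v in 𝓝[≠] x, g v = k) ↔ g t' = g t := by
        constructor
        · rintro ⟨k, hk⟩
          rw [← nhdsLT_sup_nhdsGT, eventually_sup] at hk
          obtain ⟨v, hv1, hv2⟩ := (hk.1.and (Ico_mem_nhdsLT ht'x)).exists
          obtain ⟨w, hw1, hw2⟩ := (hk.2.and (Ioc_mem_nhdsGT hx.2)).exists
          rw [← hleft v hv2, ← hright w hw2, hv1, hw1]
        · intro h
          refine ⟨g t, ?_⟩
          filter_upwards [self_mem_nhdsWithin, nhdsWithin_le_nhds (Ioo_mem_nhds ht'x hx.2)]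
            with v hv hv2
          rcases lt_or_gt_of_ne hv with h3 | h3
          · rw [hleft v ⟨hv2.1.le, h3⟩, h]
          · exact hright v ⟨h3, hv2.2.le⟩
      have hIH := ih t' hst' hsP (fun h => lt_irrefl _ (ht'P t' h)) fun u hu huP =>
        hloc u ⟨hu.1, hu.2.trans (ht'x.le.trans hx.2.le)⟩ (by
          rw [Finset.mem_insert, not_or]
          exact ⟨(hu.2.trans_lt ht'x).ne, huP⟩)
      have hfil : ({u ∈ P | u ∈ Ioo s t' ∧ ¬ ∃ k, ∀ᶠ v in 𝓝[≠] u, g v = k} : Finset ℝ) =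
          {u ∈ P | u ∈ Ioo s t ∧ ¬ ∃ k, ∀ᶠ v in 𝓝[≠] u, g v = k} := by
        refine Finset.filter_congr fun u hu => and_congr_left fun _ => ?_
        exact ⟨fun h => ⟨h.1, h.2.trans (ht'x.trans hx.2)⟩, fun h => ⟨h.1, ht'P u hu⟩⟩
      rw [hfil] at hIH
      rw [Finset.filter_insert]
      by_cases hj : g t' = g t
      · rw [if_neg (fun h => h.2 (hjump.2 hj)), hIH, hj]
      · rw [if_pos ⟨hx, fun h => hj (hjump.1 h)⟩, Finset.card_insert_of_notMem
          (fun h => hxP (Finset.mem_filter.1 h).1), Nat.odd_add_one, hIH]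
        -- With only two values available, `g t' ≠ g t` means that exactly one of `g t'`, `g t`
        -- differs from `g s`.
        have h1 := hg s
        have h2 := hg t
        have h3 := hg t'
        clear hIH hfil hjump
        omega
    · rw [Finset.filter_insert, if_neg (fun h => hx h.1)]
      refine ih t hst hsP htP fun u hu huP => hloc u hu ?_
      rw [Finset.mem_insert, not_or]
      refine ⟨?_, huP⟩
      rintro rfl
      exact hx ⟨lt_of_le_of_ne hu.1 hsx, lt_of_le_of_ne hu.2 htx.symm⟩

end Parity

/-! ### Parametrisation of the boundary circle; closedness of locally finite unions. -/

section Circle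

variable {S : Type*} [TopologicalSpace S] [ChartedSpace (EuclideanHalfSpace 2) S]

namespace QuadrangularBoundary

variable (Q : QuadrangularBoundary S)

/-- The point of the boundary component with parameter `u`. -/
noncomputable def point (u : ℝ) : S := Q.param (u : UnitAddCircle)

theorem continuous_point : Continuous Q.point :=
  Q.param.continuous.comp (AddCircle.continuous_mk' 1)

theorem point_mem_component (u : ℝ) : Q.point u ∈ Q.component := mem_range_self _

theorem point_add_one (u : ℝ) : Q.point (u + 1) = Q.point u := by
  simp only [point]
  rw [AddCircle.coe_add_period]

theorem eq_of_point_eq {u v : ℝ} (h : Q.point u = Q.point v) (huv : |u - v| < 1) : u = v := by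
  have h1 : ((u - v : ℝ) : UnitAddCircle) = 0 := by
    rw [AddCircle.coe_sub, sub_eq_zero]; exact Q.injective_param h
  obtain ⟨n, hn⟩ := AddCircle.coe_eq_zero_iff (1 : ℝ) |>.1 h1
  have hn : (n : ℝ) = u - v := by simpa using hn
  rw [← hn] at huv
  have h2 : n = 0 := by rw [← Int.abs_lt_one_iff]; exact_mod_cast huv
  rw [h2] at hn
  exact sub_eq_zero.1 (by simpa using hn.symm)

theorem exists_point_eq {z : S} (hz : z ∈ Q.component) (a : ℝ) :
    ∃ u ∈ Ico a (a + 1), Q.point u = z := by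
  obtain ⟨c, rfl⟩ := hz
  obtain ⟨u, hu, rfl⟩ := (AddCircle.coe_image_Ico_eq (1 : ℝ) a).symm ▸ mem_univ c
  exact ⟨u, hu, rfl⟩

/-- The line maps openly onto the circle, and the circle is embedded in `S`; so jumps may be read
off in the parameter or in the surface. -/
theorem exists_eventually_eq_iff [T2Space S] {f : S → ℤ} {u : ℝ} :
    (∃ k, ∀ᶠ v in 𝓝[≠] u, f (Q.point v) = k) ↔
      ∃ k, ∀ᶠ z in 𝓝 (Q.point u), z ∈ Q.component → z ≠ Q.point u → f z = k := by
  refine exists_congr fun k => ⟨fun h => ?_, fun h => ?_⟩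
  · have h := eventually_nhdsWithin_iff.1 h
    have himg : ((↑) : ℝ → UnitAddCircle) '' {v | v ∈ ({u}ᶜ : Set ℝ) → f (Q.point v) = k} ∈
        𝓝 (u : UnitAddCircle) := QuotientAddGroup.isOpenMap_coe.image_mem_nhds h
    rw [(Q.param.continuous.isClosedEmbedding Q.injective_param).isInducing.nhds_eq_comap] at himg
    obtain ⟨W, hW, hWs⟩ := himg
    filter_upwards [hW] with z hz hzc hzu
    obtain ⟨c, rfl⟩ := hzc
    obtain ⟨v, hv, rfl⟩ := hWs hz
    refine hv fun hvu => hzu ?_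
    rw [mem_singleton_iff.1 hvu]; rfl
  · refine eventually_nhdsWithin_iff.2 ?_
    filter_upwards [Q.continuous_point.continuousAt.eventually h,
      Metric.ball_mem_nhds u one_pos] with v hv hvu hne
    exact hv (Q.point_mem_component v) fun h => hne (Q.eq_of_point_eq h hvu)

end QuadrangularBoundary

theorem isClosed_sUnion_of_locallyFinite [T2Space S] {ℬ : Set (Set S)}
    (hc : ∀ A ∈ ℬ, IsClosed A)
    (hlf : ∀ K : Set S, IsCompact K → {A ∈ ℬ | (A ∩ K).Nonempty}.Finite) : IsClosed (⋃₀ ℬ) := by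
  have : LocallyCompactSpace (EuclideanHalfSpace 2) := (𝓡∂ 2).locallyCompactSpace
  have : LocallyCompactSpace S := ChartedSpace.locallyCompactSpace (EuclideanHalfSpace 2) S
  rw [sUnion_eq_iUnion]
  refine LocallyFinite.isClosed_iUnion (fun x => ?_) fun A => hc A.1 A.2
  obtain ⟨K, hK, hxK⟩ := exists_compact_mem_nhds x
  refine ⟨K, hxK, Finite.of_finite_image ?_ Subtype.val_injective.injOn⟩
  refine (hlf K hK).subset ?_
  rintro _ ⟨A, hA, rfl⟩
  exact ⟨A.2, hA⟩

end Circle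

/-! ### The pairing argument. -/

theorem mainTheorem10 {S : Type*} [TopologicalSpace S] [T2Space S] [SecondCountableTopology S]
    [ChartedSpace (EuclideanHalfSpace 2) S] (Q : QuadrangularBoundary S)
    (𝒜 : Set (Set S))
    (h𝒜 : ∀ A ∈ 𝒜, IsEssentialSimpleClosedCurve A ∨ IsEssentialSimpleArc Q.component A)
    (hdisj : 𝒜.PairwiseDisjoint id)
    (hfin : {A ∈ 𝒜 | IsEssentialSimpleArc Q.component A}.Finite)
    (hlocfin : ∀ K : Set S, IsCompact K → {A ∈ 𝒜 | (A ∩ K).Nonempty}.Finite)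
    (hbd : ∀ A ∈ 𝒜, IsEssentialSimpleArc Q.component A →
      ¬ ((A ∩ Q.b).Nonempty ∧ (A ∩ Q.d).Nonempty)) :
    ∃ p ∈ Q.a, ∃ q ∈ Q.c, ∃ γ : Path p q, ∀ A ∈ 𝒜, Disjoint (Set.range γ) A := by
  classical
  have : LocallyPathConnectedSpace S :=
    ChartedSpace.locallyPathConnectedSpace (EuclideanHalfSpace 2) S
  have t01 : Q.t 0 < Q.t 1 := Q.strictMono_t (by decide)
  have t12 : Q.t 1 < Q.t 2 := Q.strictMono_t (by decide)
  have t23 : Q.t 2 < Q.t 3 := Q.strictMono_t (by decide)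
  have t30 : Q.t 3 < Q.t 0 + 1 := Q.t_three_lt
  have hδ := Q.component_subset_boundary
  have hδ' : ∀ x ∈ Q.component, ∀ᶠ z in 𝓝 x, z ∈ (𝓡∂ 2).boundary S → z ∈ Q.component :=
    fun x hx => Q.eventually_mem_component hx
  have hclosed : ∀ A ∈ 𝒜, IsClosed A := by
    intro A hA
    rcases h𝒜 A hA with ⟨γ, -, rfl, -⟩ | ⟨p, q, α, -, rfl, -⟩
    · exact (isCompact_range γ.continuous).isClosed
    · exact (isCompact_range α.continuous).isClosed
  have hclosed' : ∀ ℬ ⊆ 𝒜, IsClosed (⋃₀ ℬ) := fun ℬ hℬ =>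
    isClosed_sUnion_of_locallyFinite (fun A hA => hclosed A (hℬ hA)) fun K hK =>
      (hlocfin K hK).subset fun A hA => ⟨hℬ hA.1, hA.2⟩
  have harc : ∀ A ∈ 𝒜, ∀ x ∈ A, x ∈ Q.component → IsEssentialSimpleArc Q.component A := by
    intro A hA x hx hxδ
    refine (h𝒜 A hA).resolve_left ?_
    rintro ⟨γ, -, -, hint, -⟩
    have := hint hx
    rw [← ModelWithCorners.compl_boundary] at this
    exact this (hδ hxδ)
  set O : Set S := (⋃₀ 𝒜)ᶜ with hO
  have hOo : IsOpen O := (hclosed' 𝒜 Subset.rfl).isOpen_compl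
  by_contra hcon
  have hno : ∀ p ∈ Q.a, ∀ q ∈ Q.c, ¬ JoinedIn O p q := by
    rintro p hp q hq ⟨γ, hγ⟩
    refine hcon ⟨p, hp, q, hq, γ, fun A hA => disjoint_left.2 ?_⟩
    rintro _ ⟨s, rfl⟩ hsA
    exact hγ s ⟨A, hA, hsA⟩
  let f : S → ℤ := fun z => if ∃ p ∈ Q.a, JoinedIn O p z then 1 else 0
  have hf01 : ∀ z, f z = 0 ∨ f z = 1 := fun z => by
    simp only [f]; split_ifs <;> simp
  have hfloc : ∀ z ∈ O, ∀ᶠ y in 𝓝 z, f y = f z := by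
    intro z hz
    filter_upwards [(hOo.pathComponentIn z).mem_nhds (mem_pathComponentIn_self hz)] with y hy
    have : (∃ p ∈ Q.a, JoinedIn O p y) ↔ ∃ p ∈ Q.a, JoinedIn O p z :=
      exists_congr fun p => and_congr_right fun _ =>
        ⟨fun h => h.trans (JoinedIn.symm hy), fun h => h.trans hy⟩
    simp only [f, this]
  have hfa : ∀ u ∈ Icc (Q.t 0) (Q.t 1), Q.point u ∈ O → f (Q.point u) = 1 := fun u hu huO =>
    if_pos ⟨Q.point u, mem_image_of_mem _ hu, JoinedIn.refl huO⟩
  have hfc : ∀ u ∈ Icc (Q.t 2) (Q.t 3), f (Q.point u) = 0 := fun u hu =>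
    if_neg fun ⟨p, hp, h⟩ => hno p hp _ (mem_image_of_mem _ hu) h
  have hinj : ∀ u ∈ Icc (Q.t 0) (Q.t 3), ∀ v ∈ Icc (Q.t 0) (Q.t 3), Q.point u = Q.point v →
      u = v := fun u hu v hv h => Q.eq_of_point_eq h (by
    rw [abs_lt]; constructor <;> linarith [hu.1, hu.2, hv.1, hv.2])
  -- There are finitely many arcs, each with at most two points on the boundary component, and
  -- closed curves do not meet it.
  have hPfin : {u ∈ Icc (Q.t 0) (Q.t 3) | Q.point u ∉ O}.Finite := by
    refine Finite.of_finite_image (f := Q.point) ?_ fun u hu v hv h => hinj u hu.1 v hv.1 h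
    refine (hfin.biUnion (t := fun A => A ∩ Q.component) fun A hA => ?_).subset ?_
    · by_cases hne : (A ∩ Q.component).Nonempty
      · obtain ⟨x, hxA, hxδ⟩ := hne
        obtain ⟨y, -, -, hsub, -⟩ := hA.2.exists_other_endpoint hδ hδ' hxA hxδ
        exact (toFinite {x, y}).subset hsub
      · rw [not_nonempty_iff_eq_empty.1 hne]; exact finite_empty
    · rintro _ ⟨u, ⟨-, hu⟩, rfl⟩
      obtain ⟨A, hA, huA⟩ := not_not.1 hu
      exact mem_biUnion (x := A) ⟨hA, harc A hA _ huA (Q.point_mem_component u)⟩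
        ⟨huA, Q.point_mem_component u⟩
  set P := hPfin.toFinset with hP
  have hmemP : ∀ u, u ∈ P ↔ u ∈ Icc (Q.t 0) (Q.t 3) ∧ Q.point u ∉ O := fun u => by
    rw [hP, Finite.mem_toFinset]; rfl
  have havoid : ∀ r r' : ℝ, r < r' → ∃ s ∈ Ioo r r', s ∉ P := fun r r' h => by
    obtain ⟨s, hs, hsP⟩ := ((Ioo_infinite h).sdiff P.finite_toSet).nonempty
    exact ⟨s, hs, hsP⟩
  -- The count of jumps starts and ends at points of `O` inside the sides `a` and `c`.
  obtain ⟨s, hs, hsP⟩ := havoid _ _ t01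
  obtain ⟨t, ht, htP⟩ := havoid _ _ t23
  have hst : s < t := hs.2.trans (t12.trans ht.1)
  have hOP : ∀ u ∈ Icc (Q.t 0) (Q.t 3), u ∉ P → Q.point u ∈ O := fun u hu huP =>
    not_not.1 fun h => huP ((hmemP u).2 ⟨hu, h⟩)
  have hevP : ∀ u, ∀ᶠ v in 𝓝[≠] u, v ∉ P := fun u => by
    have h1 : (↑(P.erase u) : Set ℝ)ᶜ ∈ 𝓝 u :=
      (P.erase u).finite_toSet.isClosed.isOpen_compl.mem_nhds (by simp)
    filter_upwards [self_mem_nhdsWithin, nhdsWithin_le_nhds h1] with v hv hv2 hvP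
    exact hv2 (Finset.mem_coe.2 (Finset.mem_erase.2 ⟨hv, hvP⟩))
  have hnja : ∀ u ∈ Ioo (Q.t 0) (Q.t 1), ∃ k, ∀ᶠ v in 𝓝[≠] u, f (Q.point v) = k := fun u hu => by
    refine ⟨1, ?_⟩
    filter_upwards [hevP u, nhdsWithin_le_nhds (Ioo_mem_nhds hu.1 hu.2)] with v hvP hv
    exact hfa v (Ioo_subset_Icc_self hv)
      (hOP v ⟨hv.1.le, hv.2.le.trans (t12.trans t23).le⟩ hvP)
  have hnjc : ∀ u ∈ Ioo (Q.t 2) (Q.t 3), ∃ k, ∀ᶠ v in 𝓝[≠] u, f (Q.point v) = k := fun u hu => by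
    refine ⟨0, ?_⟩
    filter_upwards [nhdsWithin_le_nhds (Ioo_mem_nhds hu.1 hu.2)] with v hv
    exact hfc v (Ioo_subset_Icc_self hv)
  have hodd := (odd_card_jumps_iff (g := fun u => f (Q.point u)) (fun u => hf01 _) P t hst hsP htP
    (fun u hu huP => Q.continuous_point.continuousAt.eventually (hfloc _
      (hOP u ⟨hs.1.le.trans hu.1, hu.2.trans ht.2.le⟩ huP)))).2 (by
    have h1 : f (Q.point s) = 1 := hfa s (Ioo_subset_Icc_self hs)
      (hOP s ⟨hs.1.le, hs.2.le.trans (t12.trans t23).le⟩ hsP)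
    have h2 : f (Q.point t) = 0 := hfc t (Ioo_subset_Icc_self ht)
    simp only [h1, h2]
    decide)
  set Ch := {u ∈ P | u ∈ Ioo s t ∧ ¬ ∃ k, ∀ᶠ v in 𝓝[≠] u, f (Q.point v) = k} with hCh
  have hChb : ∀ u ∈ Ch, u ∈ Icc (Q.t 1) (Q.t 2) := by
    intro u hu
    obtain ⟨-, hust, huj⟩ := Finset.mem_filter.1 hu
    constructor
    · by_contra h
      exact huj (hnja u ⟨hs.1.trans hust.1, not_le.1 h⟩)
    · by_contra h
      exact huj (hnjc u ⟨not_le.1 h, hust.2.trans ht.2⟩)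
  have hChI : ∀ u ∈ Ch, u ∈ Icc (Q.t 0) (Q.t 3) := fun u hu =>
    ⟨t01.le.trans (hChb u hu).1, (hChb u hu).2.trans t23.le⟩
  -- The other end point of the arc through a jump is again a jump, and the hypothesis on `b` and
  -- `d` forces it into `b`.
  have hpartner : ∀ u ∈ Ch, ∃ v ∈ Ch, v ≠ u ∧ ∃ A ∈ 𝒜, Q.point u ∈ A ∧ Q.point v ∈ A := by
    intro u hu
    obtain ⟨huP, -, huj⟩ := Finset.mem_filter.1 hu
    have hub : Q.point u ∈ Q.b := mem_image_of_mem _ (hChb u hu)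
    obtain ⟨A, hA, huA⟩ := not_not.1 ((hmemP u).1 huP).2
    have hAarc := harc A hA _ huA (Q.point_mem_component u)
    obtain ⟨y, ⟨hyA, hyδ⟩, hyu, -, hjump⟩ :=
      hAarc.exists_other_endpoint hδ hδ' huA (Q.point_mem_component u)
    obtain ⟨v, hv, rfl⟩ := Q.exists_point_eq hyδ (Q.t 0)
    have hvd : Q.point v ∉ Q.d := fun h => hbd A hA hAarc ⟨⟨_, huA, hub⟩, ⟨_, hyA, h⟩⟩
    -- In the parameter range chosen for `v`, the last point of `d`, with parameter `Q.t 0 + 1`,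
    -- appears as `Q.t 0`.
    have hv0 : v ≠ Q.t 0 := by
      rintro rfl
      exact hvd ⟨Q.t 0 + 1, ⟨t30.le, le_rfl⟩, Q.point_add_one _⟩
    have hv3 : v < Q.t 3 := not_le.1 fun h => hvd (mem_image_of_mem _ ⟨h, hv.2.le⟩)
    have hvj : ¬ ∃ k, ∀ᶠ w in 𝓝[≠] v, f (Q.point w) = k := by
      intro h
      -- Away from the other members of the family, whose union is closed, `f` is locally constant
      -- off `A` alone.
      refine huj (Q.exists_eventually_eq_iff.2 (hjump (⋃₀ (𝒜 \ {A}))ᶜ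
        (hclosed' _ sdiff_subset).isOpen_compl ?_ f ?_ (Q.exists_eventually_eq_iff.1 h)))
      · rintro x hx ⟨B, ⟨hB, hBA⟩, hxB⟩
        exact disjoint_left.1 (hdisj hB hA hBA) hxB hx
      · intro z hz hzA
        refine hfloc z ?_
        rintro ⟨B, hB, hzB⟩
        by_cases hBA : B = A
        · exact hzA (hBA ▸ hzB)
        · exact hz ⟨B, ⟨hB, hBA⟩, hzB⟩
    have hv1 : Q.t 1 ≤ v := not_lt.1 fun h => hvj (hnja v ⟨lt_of_le_of_ne hv.1 hv0.symm, h⟩)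
    have hv2 : v ≤ Q.t 2 := not_lt.1 fun h => hvj (hnjc v ⟨h, hv3⟩)
    refine ⟨v, Finset.mem_filter.2 ⟨(hmemP v).2 ⟨⟨hv.1, hv3.le⟩, fun h => h ⟨A, hA, hyA⟩⟩,
      ⟨hs.2.trans_le hv1, hv2.trans_lt ht.1⟩, hvj⟩, ?_, A, hA, huA, hyA⟩
    rintro rfl
    exact hyu rfl
  choose σ hσ hσne hσA using hpartner
  -- By disjointness, the arc through the partner is the original arc, which has only two end
  -- points.
  have hinvol : ∀ u hu, σ (σ u hu) (hσ u hu) = u := by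
    intro u hu
    obtain ⟨A, hA, h1, h2⟩ := hσA u hu
    obtain ⟨B, hB, h3, h4⟩ := hσA _ (hσ u hu)
    have hBA : B = A := hdisj.elim_set hB hA _ h3 h2
    subst hBA
    have hBarc := harc B hB _ h2 (Q.point_mem_component _)
    obtain ⟨y, -, -, hsub, -⟩ := hBarc.exists_other_endpoint hδ hδ' h2 (Q.point_mem_component _)
    have huy : Q.point u = y := (hsub ⟨h1, Q.point_mem_component _⟩).resolve_left fun h =>
      hσne u hu (hinj _ (hChI _ hu) _ (hChI _ (hσ u hu)) h).symm
    have hvy : Q.point (σ _ (hσ u hu)) = y :=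
      (hsub ⟨h4, Q.point_mem_component _⟩).resolve_left fun h =>
        hσne _ (hσ u hu) (hinj _ (hChI _ (hσ _ (hσ u hu))) _ (hChI _ (hσ u hu)) h)
    exact hinj _ (hChI _ (hσ _ (hσ u hu))) _ (hChI _ hu) (hvy.trans huy.symm)
  -- A fixed-point-free involution makes the sum of ones cancel modulo 2, so the number of jumps is
  -- even.
  have hsum : ∑ _u ∈ Ch, (1 : ZMod 2) = 0 :=
    Finset.sum_involution σ (fun _ _ => by decide) (fun u hu _ => hσne u hu) hσ hinvol
  rw [Finset.sum_const, nsmul_one, ZMod.natCast_eq_zero_iff_even] at hsum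
  exact Nat.not_even_iff_odd.2 hodd hsum
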